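/- Let $A$ and $B$ be finite alphabets. A substitution $(\tau, A, a)$ consists of a map $\tau$ from $A$ to the set $A^+$ of non-empty finite words on $A$ and a letter $a\in A$ such that the first letter of $\tau(a)$ is $a$; by concatenation, $\tau$ extends to finite words and to sequences in $A^{\mathbb N}$. A fixed point of $(\tau,A,a)$ is a sequence $X\in A^{\mathbb N}$ with $X_0=a$ and $\tau(X)=X$. The matrix $M_\tau=(m_{i,j})_{i,j\in A}$ has as entry $m_{i,j}$ the number of occurrences of the letter $i$ in the word $\tau(j)$; the eigenvalues of $\tau$ are the complex eigenvalues of $M_\tau$; and $\tau$ is primitive if some power $M_\tau^k$, $k\ge 1$, has only positive entries. A sequence $X$ is non-periodic if it is not ultimately periodic, i.e. not of the form $X=uvvv\cdots$ with $u$ a finite word and $v$ a non-empty finite word. Theorem. Let $(\tau,A,a)$ and $(\sigma,B,b)$ be two primitive substitutions which have the same non-periodic fixed point $X$. Then there exist integers $p\ge 1$ and $q\ge 1$ such that $\tau^p$ and $\sigma^q$ have the same eigenvalues except perhaps $0$ and roots of unity: for every $\mu\in\mathbb C$ with $\mu\neq 0$ and $\mu$ not a root of unity, $\mu$ is an eigenvalue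 of $\tau^p$ if and only if $\mu$ is an eigenvalue of $\sigma^q$. -/

import Mathlib

/-- A substitution on the alphabet `α`: a map sending each letter to a non-empty word, together
with a letter `start` such that the image of `start` begins with `start`. -/
structure Substitution (α : Type*) where
  map : α → List α
  map_ne_nil : ∀ b, map b ≠ []
  start : α
  head_map_start : (map start).head? = some start

namespace Substitution

variable {α : Type*}

/-- The induced map on finite words, by concatenation of the images of the letters. -/
def applyWord (τ : Substitution α) (w : List α) : List α :=
  w.flatMap τ.map

theorem length_le_length_applyWord (τ : Substitution α) (w : List α) :
    w.length ≤ (τ.applyWord w).length := by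
  induction w with
  | nil => simp [applyWord]
  | cons b w ih =>
    have h := List.length_pos_iff.mpr (τ.map_ne_nil b)
    simp only [applyWord, List.flatMap_cons, List.length_append, List.length_cons] at ih ⊢
    omega

theorem head_applyWord (τ : Substitution α) (w : List α) (hw : w.head? = some τ.start) :
    (τ.applyWord w).head? = some τ.start := by
  cases w with
  | nil => simp at hw
  | cons b w =>
    have hb : b = τ.start := by simpa using hw
    subst hb
    simp [applyWord, List.flatMap_cons, List.head?_append, τ.head_map_start]

/-- The word `x₀ x₁ ⋯ xₙ₋₁` formed by the first `n` letters of a sequence. -/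
def seqPrefix (x : ℕ → α) (n : ℕ) : List α :=
  List.ofFn fun i : Fin n => x i

/-- The induced map on sequences: `τ.applySeq x` is the infinite concatenation
`τ(x₀) τ(x₁) τ(x₂) ⋯`. Its letter of index `n` is read in the finite word
`τ(x₀) ⋯ τ(xₙ)`, which has length at least `n + 1` since all images are non-empty. -/
def applySeq (τ : Substitution α) (x : ℕ → α) : ℕ → α := fun n =>
  (τ.applyWord (seqPrefix x (n + 1)))[n]'(by
    have h := τ.length_le_length_applyWord (seqPrefix x (n + 1))
    simp only [seqPrefix, List.length_ofFn] at h ⊢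
    omega)

/-- `x` is the fixed point of `τ`: it begins with the start letter and `τ(x) = x`. -/
def IsFixedPoint (τ : Substitution α) (x : ℕ → α) : Prop :=
  x 0 = τ.start ∧ τ.applySeq x = x

/-- The power `τⁿ`, i.e. the `n`-th iterate of `τ`, with the same start letter. -/
def pow (τ : Substitution α) (n : ℕ) : Substitution α where
  map b := τ.applyWord^[n] [b]
  map_ne_nil b := by
    have h : ∀ k, 1 ≤ (τ.applyWord^[k] [b]).length := by
      intro k
      induction k with
      | zero => simp
      | succ k ih =>
        rw [Function.iterate_succ_apply']
        exact ih.trans (τ.length_le_length_applyWord _)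
    exact List.length_pos_iff.mp (h n)
  start := τ.start
  head_map_start := by
    induction n with
    | zero => rfl
    | succ k ih =>
      rw [Function.iterate_succ_apply']
      exact τ.head_applyWord _ ih

/-- The matrix of `τ`: the entry `(i, j)` is the number of occurrences of the letter `i`
in the word `τ(j)`. -/
def matrix [DecidableEq α] (τ : Substitution α) : Matrix α α ℤ :=
  Matrix.of fun i j => ((τ.map j).count i : ℤ)

/-- `τ` is primitive when some positive power of its matrix has only positive entries. -/
def IsPrimitive [Fintype α] [DecidableEq α] (τ : Substitution α) : Prop :=
  τ.matrix.IsPrimitive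

/-- `μ` is a (complex) eigenvalue of `τ`, i.e. of the matrix of `τ`. -/
def IsEigenvalue [Fintype α] [DecidableEq α] (τ : Substitution α) (μ : ℂ) : Prop :=
  Module.End.HasEigenvalue (Matrix.toLin' (τ.matrix.map (Int.cast : ℤ → ℂ))) μ

end Substitution

/-- The sequence `X` is ultimately periodic: `X = u v v v ⋯` for some finite word `u`
(of length `N`) and some non-empty word `v` (of length `p`). -/
def UltimatelyPeriodic {L : Type*} (X : ℕ → L) : Prop :=
  ∃ N p : ℕ, 0 < p ∧ ∀ n, N ≤ n → X (n + p) = X n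

/-- `μ` is a complex root of unity, of any positive order. -/
def IsRootOfUnity (μ : ℂ) : Prop :=
  ∃ n : ℕ, 0 < n ∧ μ ^ n = 1

/-! A substitution fixing $X$ is encoded by the map on positions $\pi(n)=|\tau(X_0\cdots X_{n-1})|$,
and its powers by iterates of $\pi$. Thus two substitutions on different alphabets act on the same
object: the occurrences in $X$ of its prefixes, which cut $X$ into return words.

Primitivity makes all gaps of $\pi^{n}$ comparable, and non-periodicity then keeps the occurrences
of an inflated prefix far apart (`exists_separation`). Hence an inflated window holds boundedly many
of them, and from some level on $\pi$ maps occurrences of one inflated prefix onto those of the next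
(`exists_occ_stable`). For a suitable $\ell$ this yields a substitution on return words, with matrix
$S$ for $\tau$ and $T$ for $\sigma$.

Return words of a longer prefix are concatenations of return words of a shorter one. Comparing
prefixes of comparable length at level $n$ for $\tau$ and $m(n)$ for $\sigma$ gives matrices $P_n$
with bounded natural entries. By pigeonhole $P_n=P_{n'}$ for some $n<n'$, so $S^pP=PT^q$; as $P$
divides powers of $S$ and $T$, $S^p$ and $T^q$ share their nonzero eigenvalues
(`exists_pow_hasEigenvalue_iff`).

Counting letters in return words intertwines $S$ with $M_\tau$. What this map loses stays bounded
under iteration, so eigenvalues of modulus $>1$ are unaffected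
(`ReturnCoding.hasEigenvalue_pow_iff`). By Kronecker's theorem a nonzero algebraic integer that is
not a root of unity has a conjugate of modulus $>1$, and integer characteristic polynomials carry
the conclusion back to it. -/

section Combinatorics

/-! ### Inflations of a sequence and recurrence of its prefixes. -/

variable {L : Type*} {X : ℕ → L} {π : ℕ → ℕ}

/-- The factors of `X` of length `d` at the positions `i` and `j` are equal. -/
def SameWord (X : ℕ → L) (i j d : ℕ) : Prop := ∀ t < d, X (i + t) = X (j + t)

/-- The occurrences in `X` of its prefix of length `ℓ`. -/
def prefixOcc (X : ℕ → L) (ℓ : ℕ) : Set ℕ := {i | ∀ t < ℓ, X (i + t) = X t}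

/-- The map on positions `n ↦ |τ(X₀ ⋯ Xₙ₋₁)|` attached to a substitution `τ` fixing `X`,
described without reference to `τ`. -/
structure Inflation (X : ℕ → L) (π : ℕ → ℕ) : Prop where
  zero : π 0 = 0
  strictMono : StrictMono π
  gap : ∀ {i j}, X i = X j → π (i + 1) + π j = π (j + 1) + π i
  word : ∀ {i j}, X i = X j → ∀ t, π i + t < π (i + 1) → X (π i + t) = X (π j + t)

theorem SameWord.mono {i j d e : ℕ} (h : SameWord X i j d) (he : e ≤ d) : SameWord X i j e :=
  fun t ht => h t (ht.trans_le he)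

theorem SameWord.shift {i j d s e : ℕ} (h : SameWord X i j d) (he : s + e ≤ d) :
    SameWord X (i + s) (j + s) e := by
  intro t ht
  have := h (s + t) (by omega)
  simpa [add_assoc] using this

theorem zero_mem_prefixOcc (ℓ : ℕ) : 0 ∈ prefixOcc X ℓ := by
  intro t _; simp

theorem prefixOcc_anti {ℓ ℓ' : ℕ} (h : ℓ ≤ ℓ') : prefixOcc X ℓ' ⊆ prefixOcc X ℓ :=
  fun _ hi t ht => hi t (ht.trans_le h)

theorem mem_prefixOcc_iff_of_sameWord {i j ℓ : ℕ} (h : SameWord X i j ℓ) :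
    i ∈ prefixOcc X ℓ ↔ j ∈ prefixOcc X ℓ :=
  ⟨fun hi t ht => (h t ht).symm.trans (hi t ht), fun hi t ht => (h t ht).trans (hi t ht)⟩

/-- Two equal factors followed by occurrences of a prefix can be extended by that prefix. -/
theorem SameWord.extend {i j d ℓ : ℕ} (h : SameWord X i j d) (hi : i + d ∈ prefixOcc X ℓ)
    (hj : j + d ∈ prefixOcc X ℓ) : SameWord X i j (d + ℓ) := by
  intro t ht
  rcases lt_or_ge t d with h1 | h1
  · exact h t h1
  · have e1 := hi (t - d) (by omega)
    have e2 := hj (t - d) (by omega)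
    rw [show i + d + (t - d) = i + t by omega] at e1
    rw [show j + d + (t - d) = j + t by omega] at e2
    rw [e1, e2]

theorem Nat.le_add_mul_of_gap {f : ℕ → ℕ} {K : ℕ} (hK : ∀ i, f (i + 1) ≤ f i + K) (a d : ℕ) :
    f (a + d) ≤ f a + d * K := by
  induction d with
  | zero => simp
  | succ d ih =>
    have := hK (a + d)
    rw [← add_assoc, add_mul]
    omega

theorem StrictMono.exists_block (hm : StrictMono π) (h0 : π 0 = 0) (q : ℕ) :
    ∃ s, π s ≤ q ∧ q < π (s + 1) := by
  have hex : ∃ s, q < π (s + 1) := ⟨q, (Nat.lt_succ_self q).trans_le (hm.id_le _)⟩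
  classical
  refine ⟨Nat.find hex, ?_, Nat.find_spec hex⟩
  rcases Nat.eq_zero_or_pos (Nat.find hex) with h | h
  · rw [h, h0]; exact Nat.zero_le q
  · have := Nat.find_min hex (m := Nat.find hex - 1) (by omega)
    rw [Nat.sub_add_cancel h] at this
    omega

namespace Inflation

theorem gap_of_sameWord (h : Inflation X π) {i j d : ℕ} (hw : SameWord X i j d) :
    ∀ e ≤ d, π (i + e) + π j = π (j + e) + π i := by
  intro e
  induction e with
  | zero => intro _; simp [add_comm]
  | succ e ih =>
    intro he
    have h1 := ih (by omega)
    have h2 := h.gap (hw e (by omega))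
    simp only [← add_assoc]
    omega

/-- Images of equal letters have equal lengths, so the images of two equal factors stay aligned
letter by letter. -/
theorem sameWord (h : Inflation X π) {i j d : ℕ} (hw : SameWord X i j d) :
    SameWord X (π i) (π j) (π (i + d) - π i) := by
  intro t ht
  induction d with
  | zero => simp at ht
  | succ d ih =>
    rcases lt_or_ge t (π (i + d) - π i) with h1 | h1
    · exact ih (hw.mono (Nat.le_succ d)) h1
    · have h2 := h.gap_of_sameWord hw d (by omega)
      have m1 := h.strictMono.monotone (Nat.le_add_right i d)
      have m2 := h.strictMono.monotone (Nat.le_add_right j d)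
      rw [← add_assoc] at ht
      have := h.word (hw d (by omega)) (t - (π (i + d) - π i)) (by omega)
      rw [show π (i + d) + (t - (π (i + d) - π i)) = π i + t by omega] at this
      rw [show π (j + d) + (t - (π (i + d) - π i)) = π j + t by omega] at this
      exact this

theorem mem_prefixOcc (h : Inflation X π) {i ℓ : ℕ} (hi : i ∈ prefixOcc X ℓ) :
    π i ∈ prefixOcc X (π ℓ) := by
  have hw : SameWord X 0 i ℓ := fun t ht => by simpa using (hi t ht).symm
  intro t ht
  have := h.sameWord hw t (by simpa [h.zero] using ht)
  simpa [h.zero] using this.symm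

theorem id : Inflation X (fun n => n) where
  zero := rfl
  strictMono := strictMono_id
  gap := fun _ => by omega
  word := fun {i j} hij t ht => by
    obtain rfl : t = 0 := by omega
    simpa using hij

theorem comp {ρ : ℕ → ℕ} (h : Inflation X π) (h' : Inflation X ρ) :
    Inflation X (π ∘ ρ) where
  zero := by simp [h.zero, h'.zero]
  strictMono := h.strictMono.comp h'.strictMono
  gap := fun {i j} hij => by
    have hw : SameWord X i j 1 := fun t ht => by obtain rfl : t = 0 := by omega
                                                 simpa using hij
    have g := h'.gap hij
    have m1 := h'.strictMono (Nat.lt_succ_self i)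
    have m2 := h'.strictMono (Nat.lt_succ_self j)
    have := h.gap_of_sameWord (h'.sameWord hw) _ le_rfl
    simp only [Nat.succ_eq_add_one] at *
    rw [show ρ i + (ρ (i + 1) - ρ i) = ρ (i + 1) by omega,
      show ρ j + (ρ (i + 1) - ρ i) = ρ (j + 1) by omega] at this
    exact this
  word := fun {i j} hij t ht => by
    have hw : SameWord X i j 1 := fun t ht => by obtain rfl : t = 0 := by omega
                                                 simpa using hij
    have m1 := h'.strictMono (Nat.lt_succ_self i)
    refine h.sameWord (h'.sameWord hw) t ?_
    simp only [Nat.succ_eq_add_one, Function.comp] at *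
    rw [show ρ i + (ρ (i + 1) - ρ i) = ρ (i + 1) by omega]
    omega

theorem iterate (h : Inflation X π) (n : ℕ) : Inflation X (π^[n]) := by
  induction n with
  | zero => exact Inflation.id
  | succ n ih => rw [Function.iterate_succ']; exact h.comp ih

theorem sub_le_sub (h : Inflation X π) {a b : ℕ} (hab : a ≤ b) : b - a ≤ π b - π a := by
  obtain ⟨d, rfl⟩ := Nat.exists_eq_add_of_le hab
  have : ∀ d, π a + d ≤ π (a + d) := by
    intro d
    induction d with
    | zero => simp
    | succ d ih =>
      have := h.strictMono (Nat.lt_succ_self (a + d))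
      have hd := ih
      simp only [Nat.succ_eq_add_one, ← add_assoc] at *
      omega
  have := this d
  omega

end Inflation

theorem exists_bound_of_finite_range {α : Type*} (f : ℕ → α) (hf : (Set.range f).Finite) :
    ∃ N, ∀ s, ∃ s' < N, f s' = f s := by
  classical
  have : ∀ a ∈ Set.range f, ∃ s, f s = a := fun a ha => ha
  choose! g hg using this
  obtain ⟨N, hN⟩ := (hf.image g).bddAbove
  refine ⟨N + 1, fun s => ⟨g (f s), ?_, hg _ ⟨s, rfl⟩⟩⟩
  exact Nat.lt_succ_of_le (hN ⟨f s, ⟨s, rfl⟩, rfl⟩)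

theorem exists_bound_of_factor {α : Type*} {f : ℕ → α} (hf : (Set.range f).Finite) {g : ℕ → ℕ}
    (h : ∀ i j, f i = f j → g i = g j) : ∃ K, ∀ i, g i ≤ K := by
  obtain ⟨N, hN⟩ := exists_bound_of_finite_range f hf
  refine ⟨(Finset.range N).sup g, fun i => ?_⟩
  obtain ⟨s, hs, e⟩ := hN i
  rw [← h _ _ e]
  exact Finset.le_sup (Finset.mem_range.2 hs)

/-- An inflation coming from a primitive substitution on a non-periodic sequence. -/
structure PrimitiveInflation (X : ℕ → L) (π : ℕ → ℕ) : Prop extends Inflation X π where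
  prim : ∃ k, ∀ i i', ∃ t, π^[k] i ≤ t ∧ t < π^[k] (i + 1) ∧ X t = X i'
  finite : (Set.range X).Finite
  aperiodic : ¬ UltimatelyPeriodic X

namespace Inflation

theorem exists_gap_bound (h : Inflation X π) (hf : (Set.range X).Finite) :
    ∃ K, ∀ i, π (i + 1) ≤ π i + K := by
  obtain ⟨K, hK⟩ := exists_bound_of_factor hf (g := fun i => π (i + 1) - π i) (fun i j hij => by
    have := h.gap hij
    have m1 := h.strictMono (Nat.lt_succ_self i)
    have m2 := h.strictMono (Nat.lt_succ_self j)
    simp only [Nat.succ_eq_add_one] at *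
    omega)
  exact ⟨K, fun i => by have := hK i; omega⟩

end Inflation

namespace PrimitiveInflation

variable (h : PrimitiveInflation X π)
include h

/-- The gaps of the iterates are comparable. -/
theorem exists_gap_ratio :
    ∃ C, 0 < C ∧ ∀ n i j, π^[n] (i + 1) - π^[n] i ≤ C * (π^[n] (j + 1) - π^[n] j) := by
  obtain ⟨k, hk⟩ := h.prim
  obtain ⟨K, hK⟩ := (h.toInflation.iterate k).exists_gap_bound h.finite
  have pos : ∀ n j, 1 ≤ π^[n] (j + 1) - π^[n] j := fun n j => by
    have := (h.toInflation.iterate n).strictMono (Nat.lt_succ_self j)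
    simp only [Nat.succ_eq_add_one] at this
    omega
  refine ⟨K + 1, K.succ_pos, fun n i j => ?_⟩
  -- Below the primitivity exponent `k`, a gap is at most the corresponding gap of `π^[k]`, hence at
  -- most `K`, while every gap is at least 1.
  rcases lt_or_ge n k with hn | hn
  · have h1 : π^[n] (i + 1) - π^[n] i ≤ π^[k] (i + 1) - π^[k] i := by
      have := (h.toInflation.iterate (k - n)).sub_le_sub
        ((h.toInflation.iterate n).strictMono.monotone (Nat.le_succ i))
      rwa [← Function.iterate_add_apply, ← Function.iterate_add_apply,
        Nat.sub_add_cancel hn.le] at this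
    have h2 := hK i
    have h3 := Nat.mul_le_mul_left (K + 1) (pos n j)
    omega
  · obtain ⟨m, rfl⟩ := Nat.exists_eq_add_of_le' hn
    -- gaps of `π^[m]` are bounded by every gap of `π^[m + k]`
    have key : ∀ i', π^[m] (i' + 1) - π^[m] i' ≤ π^[m + k] (j + 1) - π^[m + k] j := by
      intro i'
      obtain ⟨t, h1, h2, h3⟩ := hk j i'
      have hm := (h.toInflation.iterate m)
      have g := hm.gap h3
      have m1 := hm.strictMono.monotone h1
      have m2 := hm.strictMono.monotone (show t + 1 ≤ _ from h2)
      rw [Function.iterate_add_apply, Function.iterate_add_apply]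
      have := hm.strictMono (Nat.lt_succ_self i')
      simp only [Nat.succ_eq_add_one] at *
      omega
    have hm := (h.toInflation.iterate m)
    -- A gap at level `m + k` is made of at most `K` gaps of level `m`, each bounded by `key`.
    have := Nat.le_add_mul_of_gap (f := π^[m]) (K := π^[m + k] (j + 1) - π^[m + k] j)
      (fun i' => by have := key i'; omega) (π^[k] i) (π^[k] (i + 1) - π^[k] i)
    have mk := (h.toInflation.iterate k).strictMono.monotone (Nat.le_succ i)
    rw [Nat.succ_eq_add_one] at mk
    rw [Nat.add_sub_cancel' mk, ← Function.iterate_add_apply, ← Function.iterate_add_apply] at this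
    have h4 : π^[k] (i + 1) - π^[k] i ≤ K := by have := hK i; omega
    have h5 := Nat.mul_le_mul_right (π^[m + k] (j + 1) - π^[m + k] j) (h4.trans (Nat.le_succ K))
    rw [Nat.succ_eq_add_one] at h5
    omega

/-- A fixed position `i > 0` would force `π^[k] 1 = 1`; by primitivity the letter `X 0` would be the
only one, and `X` would be constant. -/
theorem lt_apply {i : ℕ} (hi : 0 < i) : i < π i := by
  by_contra hcon
  have heq : π i = i := le_antisymm (not_lt.1 hcon) (h.strictMono.id_le i)
  obtain ⟨k, hk⟩ := h.prim
  have hfix : ∀ n, π^[n] i = i := fun n => Function.iterate_fixed heq n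
  have hk1 : π^[k] 1 = 1 := by
    have h1 := (h.toInflation.iterate k).sub_le_sub (show 1 ≤ i from hi)
    rw [hfix] at h1
    have h2 := (h.toInflation.iterate k).strictMono.id_le 1
    simp only [_root_.id] at h2
    have h3 := (h.toInflation.iterate k).strictMono.monotone (show 1 ≤ i from hi)
    rw [hfix] at h3
    omega
  apply h.aperiodic
  refine ⟨0, 1, one_pos, fun n _ => ?_⟩
  have : ∀ i', X i' = X 0 := by
    intro i'
    obtain ⟨t, _, h2, h3⟩ := hk 0 i'
    rw [zero_add, hk1] at h2
    obtain rfl : t = 0 := by omega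
    exact h3.symm
  rw [this (n + 1), this n]

theorem add_le_iterate (n : ℕ) {i : ℕ} (hi : 0 < i) : i + n ≤ π^[n] i := by
  induction n with
  | zero => simp
  | succ n ih =>
    rw [Function.iterate_succ_apply']
    have := h.lt_apply (show 0 < π^[n] i by omega)
    omega

/-- The occurrences of a prefix have bounded gaps. -/
theorem exists_occ_gap (ℓ : ℕ) : ∃ g, ∀ q, ∃ i ∈ prefixOcc X ℓ, q < i ∧ i ≤ q + g := by
  obtain ⟨k, hk⟩ := h.prim
  obtain ⟨K, hK⟩ := (h.toInflation.iterate (ℓ + k)).exists_gap_bound h.finite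
  refine ⟨2 * K, fun q => ?_⟩
  obtain ⟨s, h1, h2⟩ := (h.toInflation.iterate (ℓ + k)).strictMono.exists_block
    (h.toInflation.iterate (ℓ + k)).zero q
  -- In `ℓ + k`, the `k` steps make the initial letter appear and the other `ℓ` inflate it to a
  -- prefix longer than `ℓ`. Using the block after that of `q` puts the occurrence beyond `q`,
  -- whence `2 * K`.
  obtain ⟨t, t1, t2, t3⟩ := hk (s + 1) 0
  have hn := h.toInflation.iterate ℓ
  have e1 := hn.strictMono.monotone t1
  have e2 := hn.strictMono t2
  rw [← Function.iterate_add_apply] at e1 e2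
  have k1 := hK s
  have k2 := hK (s + 1)
  refine ⟨π^[ℓ] t, ?_, by omega, by omega⟩
  have ht : t ∈ prefixOcc X 1 := fun u hu => by
    obtain rfl : u = 0 := by omega
    simpa using t3
  have := h.add_le_iterate ℓ one_pos
  exact prefixOcc_anti (by omega) (hn.mem_prefixOcc ht)

/-- Occurrences of inflated long prefixes are far apart. -/
theorem exists_separation : ∃ ℓ₁ C, 0 < C ∧ ∀ ℓ, ℓ₁ ≤ ℓ → ∀ n i j t, i < j →
    i ∈ prefixOcc X (π^[n] ℓ) → j ∈ prefixOcc X (π^[n] ℓ) →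
    π^[n] (t + 1) - π^[n] t ≤ C * (j - i) := by
  obtain ⟨C, hC, hgap⟩ := h.exists_gap_ratio
  have hfin : (Set.range fun s => (X s, X (s + 1))).Finite :=
    (h.finite.prod h.finite).subset (by rintro _ ⟨s, rfl⟩; exact ⟨⟨s, rfl⟩, ⟨s + 1, rfl⟩⟩)
  obtain ⟨N, hN⟩ := exists_bound_of_finite_range _ hfin
  -- All two-letter factors of `X` occur in its prefix of length `N + 1`.
  refine ⟨N + 1, C, hC, fun ℓ hℓ n i j t hij hi hj => ?_⟩
  by_contra hcon
  rw [not_le] at hcon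
  have hn := h.toInflation.iterate n
  have hd : ∀ s, j - i < π^[n] (s + 1) - π^[n] s := fun s => by
    have := hgap n t s
    exact lt_of_mul_lt_mul_left (hcon.trans_le this) (Nat.zero_le C)
  have hper : ∀ u, u + (j - i) < π^[n] ℓ → X (u + (j - i)) = X u := by
    intro u hu
    have e1 := hi (u + (j - i)) hu
    have e2 := hj u (by omega)
    rw [show i + (u + (j - i)) = j + u by omega] at e1
    rw [← e1, e2]
  -- The overlap gives the inflated prefix the period `j - i`, shorter than every block. Any two
  -- consecutive blocks of `X` are copied in that prefix, so all of `X` has this period.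
  apply h.aperiodic
  refine ⟨0, j - i, by omega, fun q _ => ?_⟩
  obtain ⟨s, h1, h2⟩ := hn.strictMono.exists_block hn.zero q
  obtain ⟨s', hs', e⟩ := hN s
  have hw : SameWord X s s' 2 := by
    intro t ht
    have e1 := congrArg Prod.fst e
    have e2 := congrArg Prod.snd e
    simp only at e1 e2
    interval_cases t
    · exact e1.symm
    · exact e2.symm
  have g1 := hn.gap_of_sameWord hw 2 le_rfl
  have hW := hn.sameWord hw
  have g2 := hd (s + 1)
  rw [show s + 1 + 1 = s + 2 from rfl] at g2
  have m1 := hn.strictMono (show s < s + 2 by omega)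
  have m2 := hn.strictMono.monotone (show s' + 2 ≤ ℓ by omega)
  have a1 := hW (q + (j - i) - π^[n] s) (by omega)
  have a2 := hW (q - π^[n] s) (by omega)
  rw [show π^[n] s + (q + (j - i) - π^[n] s) = q + (j - i) by omega] at a1
  rw [show π^[n] s + (q - π^[n] s) = q by omega] at a2
  have a3 := hper (π^[n] s' + (q - π^[n] s)) (by omega)
  rw [a1, a2, ← a3]
  congr 1
  omega

end PrimitiveInflation

end Combinatorics

/-! ### Return words and their stability under inflation. -/

section ReturnWords

variable {L : Type*} {X : ℕ → L} {π : ℕ → ℕ}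

/-- The word `X a ⋯ X (b - 1)`. -/
def factor (X : ℕ → L) (a b : ℕ) : List L := List.ofFn fun t : Fin (b - a) => X (a + t)

theorem factor_eq_iff {a b a' b' : ℕ} :
    factor X a b = factor X a' b' ↔ b - a = b' - a' ∧ SameWord X a a' (b - a) := by
  constructor
  · intro h
    have hl : b - a = b' - a' := by simpa [factor] using congrArg List.length h
    refine ⟨hl, fun t ht => ?_⟩
    have := congrArg (fun l => l[t]?) h
    simpa [factor, ht, hl ▸ ht] using this
  · rintro ⟨hl, hw⟩
    apply List.ext_getElem
    · simpa [factor] using hl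
    · intro t h1 h2
      have := hw t (by simpa [factor] using h1)
      simpa [factor] using this

theorem finite_range_of_factor {ι α β : Type*} {f : ι → α} {g : ι → β}
    (hf : (Set.range f).Finite) (h : ∀ i j, f i = f j → g i = g j) : (Set.range g).Finite := by
  classical
  have : ∀ a ∈ Set.range f, ∃ s, f s = a := fun a ha => ha
  rcases isEmpty_or_nonempty ι with _ | _
  · exact Set.finite_range g
  choose! s hs using this
  refine (hf.image (g ∘ s)).subset ?_
  rintro _ ⟨i, rfl⟩
  exact ⟨f i, ⟨i, rfl⟩, h _ _ (hs _ ⟨i, rfl⟩)⟩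

theorem finite_range_window (hX : (Set.range X).Finite) (d : ℕ) :
    (Set.range fun i => fun t : Fin d => X (i + t)).Finite := by
  refine (Set.Finite.pi' (t := fun _ : Fin d => Set.range X) fun _ => hX).subset ?_
  rintro _ ⟨i, rfl⟩ t
  exact ⟨_, rfl⟩

theorem exists_bound_window (hX : (Set.range X).Finite) (d : ℕ) :
    ∃ N, ∀ i, ∃ i' < N, SameWord X i i' d := by
  obtain ⟨N, hN⟩ := exists_bound_of_finite_range _ (finite_range_window hX d)
  refine ⟨N, fun i => ?_⟩
  obtain ⟨i', h1, h2⟩ := hN i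
  exact ⟨i', h1, fun t ht => (congrFun h2 ⟨t, ht⟩).symm⟩

theorem finite_range_factor (hX : (Set.range X).Finite) {q : ℕ → ℕ} {g : ℕ}
    (hg : ∀ k, q (k + 1) ≤ q k + g) :
    (Set.range fun k => factor X (q k) (q (k + 1))).Finite := by
  have h1 : (Set.range fun k => ((fun t : Fin g => X (q k + t)), q (k + 1) - q k)).Finite := by
    refine ((finite_range_window hX g).prod (Set.finite_Iic g)).subset ?_
    rintro _ ⟨k, rfl⟩
    exact ⟨⟨q k, rfl⟩, by have := hg k; simp only [Set.mem_Iic]; omega⟩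
  refine finite_range_of_factor h1 fun i j hij => ?_
  obtain ⟨e1, e2⟩ := Prod.mk.inj hij
  refine factor_eq_iff.2 ⟨e2, fun t ht => ?_⟩
  have := hg i
  exact congrFun e1 ⟨t, by omega⟩

/-- The map $i\mapsto\lfloor C(i-a)/E\rfloor$ is injective on these points and takes values in
$[0,B]$. -/
theorem ncard_inter_Ico_le_of_separated {S : Set ℕ} {E C B a b : ℕ} (hE : 0 < E)
    (hS : ∀ i ∈ S, ∀ j ∈ S, i < j → E ≤ C * (j - i)) (hB : C * (b - a) ≤ B * E) :
    (S ∩ Set.Ico a b).ncard ≤ B + 1 := by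
  have key : ∀ i ∈ S, ∀ j ∈ S, a ≤ i → i < j → C * (i - a) / E < C * (j - a) / E := by
    intro i hi j hj hai hij
    have h1 := hS i hi j hj hij
    have h2 : C * (j - a) = C * (i - a) + C * (j - i) := by
      rw [← mul_add]; congr 1; omega
    calc C * (i - a) / E < C * (i - a) / E + 1 := Nat.lt_succ_self _
      _ = (C * (i - a) + E) / E := (Nat.add_div_right _ hE).symm
      _ ≤ _ := Nat.div_le_div_right (by omega)
  have hinj : Set.InjOn (fun i => C * (i - a) / E) (S ∩ Set.Ico a b) := by
    intro i hi j hj hij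
    rcases lt_trichotomy i j with h | h | h
    · exact absurd hij (key i hi.1 j hj.1 hi.2.1 h).ne
    · exact h
    · exact absurd hij (key j hj.1 i hi.1 hj.2.1 h).ne'
  rw [← hinj.ncard_image]
  calc _ ≤ (Set.Iio (B + 1)).ncard := by
        apply Set.ncard_le_ncard _ (Set.finite_Iio _)
        rintro _ ⟨i, hi, rfl⟩
        simp only [Set.mem_Iio]
        rw [Nat.lt_succ_iff]
        apply Nat.div_le_of_le_mul
        rw [mul_comm E]
        exact (Nat.mul_le_mul_left _ (by have := hi.2.2; omega)).trans hB
    _ = B + 1 := by rw [Set.ncard_eq_toFinset_card']; simp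

/-- The maximum of a bounded sequence of natural numbers is attained. -/
theorem exists_forall_apply_le {c : ℕ → ℕ} {B : ℕ} (hB : ∀ n, c n ≤ B) : ∃ n, ∀ m, c m ≤ c n := by
  refine ⟨Function.argmin (fun n => B - c n), fun m => ?_⟩
  have := Function.argmin_le (fun n => B - c n) m
  have h1 := hB m
  have h2 := hB (Function.argmin (fun n => B - c n))
  omega

/-- The occurrences of long prefixes of `X` are eventually compatible with `π`. -/
theorem PrimitiveInflation.exists_occ_stable (h : PrimitiveInflation X π) {ℓ C : ℕ}
    (hsep : ∀ n i j t, i < j → i ∈ prefixOcc X (π^[n] ℓ) → j ∈ prefixOcc X (π^[n] ℓ) →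
      π^[n] (t + 1) - π^[n] t ≤ C * (j - i)) :
    ∃ n₁, ∀ n, n₁ ≤ n → prefixOcc X (π^[n + 1] ℓ) ⊆ π '' prefixOcc X (π^[n] ℓ) := by
  obtain ⟨g, hg⟩ := h.exists_occ_gap ℓ
  obtain ⟨N, hN⟩ := exists_bound_window h.finite (g + ℓ)
  obtain ⟨C', -, hC'⟩ := h.exists_gap_ratio
  set J := N + g + 1 with hJ
  set S : ℕ → Set ℕ := fun n => prefixOcc X (π^[n] ℓ) ∩ Set.Ico 0 (π^[n] J) with hS
  have hfin : ∀ n, (S n).Finite := fun n => (Set.finite_Ico _ _).inter_of_right _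
  have hsub : ∀ n, π '' S n ⊆ S (n + 1) := by
    rintro n _ ⟨i, ⟨h1, -, h2⟩, rfl⟩
    rw [hS]
    simp only [Function.iterate_succ_apply']
    exact ⟨h.mem_prefixOcc h1, Nat.zero_le _, h.strictMono h2⟩
  have hcard : ∀ n, (π '' S n).ncard = (S n).ncard := fun n =>
    Set.ncard_image_of_injective _ h.strictMono.injective
  have hmono : Monotone fun n => (S n).ncard := monotone_nat_of_le_succ fun n => by
    rw [← hcard n]; exact Set.ncard_le_ncard (hsub n) (hfin _)
  have hbdd : ∀ n, (S n).ncard ≤ C * (J * C') + 1 := by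
    intro n
    have hn := h.toInflation.iterate n
    have hpos := h.add_le_iterate n one_pos
    apply ncard_inter_Ico_le_of_separated (E := π^[n] 1) (C := C) (by omega)
    · intro i hi j hj hij
      have := hsep n i j 0 hij hi hj
      simpa [hn.zero] using this
    · have h1 := Nat.le_add_mul_of_gap (f := π^[n]) (K := C' * π^[n] 1) (fun i => by
        have := hC' n i 0
        simp only [zero_add, hn.zero, Nat.sub_zero] at this
        omega) 0 J
      simp only [zero_add, hn.zero, Nat.sub_zero] at h1 ⊢
      calc C * π^[n] J ≤ C * (J * (C' * π^[n] 1)) := Nat.mul_le_mul_left _ h1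
        _ = _ := by ring
  -- The cardinality of `S n` is nondecreasing and bounded, so it is constant from `n₁` on, and
  -- there the injection `π : S n → S (n + 1)` is onto.
  obtain ⟨n₁, hn₁⟩ := exists_forall_apply_le hbdd
  have hsucc : ∀ n x, π (π^[n] x) = π^[n + 1] x := fun n x =>
    (Function.iterate_succ_apply' π n x).symm
  refine ⟨n₁, fun n hn q hq => ?_⟩
  have heq : π '' S n = S (n + 1) := by
    apply Set.eq_of_subset_of_ncard_le (hsub n) _ (hfin _)
    rw [hcard]
    exact (hn₁ _).trans (hmono hn)
  have i1 := h.toInflation.iterate (n + 1)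
  have i0 := h.toInflation.iterate n
  -- An arbitrary `q` is moved into the initial window: the factor from its block `s` through the
  -- next occurrence of the `ℓ`-prefix recurs at some `s' < N`. That occurrence, once inflated,
  -- supplies the letters needed to recognise every prefix occurrence starting before it.
  obtain ⟨s, s1, s2⟩ := i1.strictMono.exists_block i1.zero q
  obtain ⟨j, hj, j1, j2⟩ := hg s
  obtain ⟨s', hs', hw⟩ := hN s
  obtain ⟨d, rfl⟩ := Nat.exists_eq_add_of_lt j1
  rw [add_assoc] at hj j1 j2
  set e := d + 1 with he
  have hw' : SameWord X s s' (e + ℓ) := hw.mono (by omega)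
  have hj' : s' + e ∈ prefixOcc X ℓ :=
    (mem_prefixOcc_iff_of_sameWord (hw'.shift le_rfl)).1 hj
  -- equal windows at every level
  have win : ∀ m, SameWord X (π^[m] s) (π^[m] s') ((π^[m] (s + e) - π^[m] s) + π^[m] ℓ) ∧
      π^[m] (s + e) + π^[m] s' = π^[m] (s' + e) + π^[m] s ∧ π^[m] s ≤ π^[m] (s + e) ∧
      π^[m] s' ≤ π^[m] (s' + e) := by
    intro m
    have im := h.toInflation.iterate m
    have g1 := im.gap_of_sameWord hw' e (by omega)
    have m1 := im.strictMono.monotone (Nat.le_add_right s e)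
    have m2 := im.strictMono.monotone (Nat.le_add_right s' e)
    refine ⟨(im.sameWord (hw'.mono (Nat.le_add_right e ℓ))).extend ?_ ?_, g1, m1, m2⟩
    · rw [Nat.add_sub_cancel' m1]
      exact im.mem_prefixOcc hj
    · rw [show π^[m] s' + (π^[m] (s + e) - π^[m] s) = π^[m] (s' + e) by omega]
      exact im.mem_prefixOcc hj'
  obtain ⟨w1, g1, a1, b1⟩ := win (n + 1)
  obtain ⟨w0, g0, a0, b0⟩ := win n
  have hq1 : q < π^[n + 1] (s + e) :=
    s2.trans_le (i1.strictMono.monotone (by omega))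
  have hq' : π^[n + 1] s' + (q - π^[n + 1] s) ∈ prefixOcc X (π^[n + 1] ℓ) := by
    rw [← mem_prefixOcc_iff_of_sameWord (w1.shift (s := q - π^[n + 1] s)
      (e := π^[n + 1] ℓ) (by omega)), Nat.add_sub_cancel' s1]
    exact hq
  have hJ1 : π^[n + 1] (s' + e) ≤ π^[n + 1] J := i1.strictMono.monotone (by omega)
  have hq'' : π^[n + 1] s' + (q - π^[n + 1] s) ∈ S (n + 1) :=
    ⟨hq', Nat.zero_le _, by omega⟩
  rw [← heq] at hq''
  obtain ⟨t, ⟨ht, -⟩, ht'⟩ := hq''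
  have t1 : π^[n] s' ≤ t := by
    apply h.strictMono.le_iff_le.1
    rw [ht', hsucc]
    omega
  have t2 : t < π^[n] (s' + e) := by
    apply h.strictMono.lt_iff_lt.1
    rw [ht', hsucc]
    omega
  refine ⟨π^[n] s + (t - π^[n] s'), ?_, ?_⟩
  · rw [mem_prefixOcc_iff_of_sameWord (w0.shift (s := t - π^[n] s')
      (e := π^[n] ℓ) (by omega)), Nat.add_sub_cancel' t1]
    exact ht
  · have := h.gap_of_sameWord w0 (t - π^[n] s') (by omega)
    rw [Nat.add_sub_cancel' t1, ht', hsucc, hsucc] at this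
    omega

/-- `o` enumerates the occurrences of the prefix of length `ℓ`, and the iterates of `π` carry
occurrences and return words bijectively to those of the inflated prefixes. -/
structure ReturnCoding (X : ℕ → L) (π : ℕ → ℕ) (ℓ : ℕ) (o : ℕ → ℕ) : Prop where
  pos : 0 < ℓ
  strictMono : StrictMono o
  range_eq : ∀ n, Set.range (fun k => π^[n] (o k)) = prefixOcc X (π^[n] ℓ)
  factor_inj : ∀ n k k', factor X (π^[n] (o k)) (π^[n] (o (k + 1))) =
    factor X (π^[n] (o k')) (π^[n] (o (k' + 1))) →
    factor X (o k) (o (k + 1)) = factor X (o k') (o (k' + 1))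
  gap : ∃ g, ∀ k, o (k + 1) ≤ o k + g
  sep : ∃ C, ∀ n i j t, i < j → i ∈ prefixOcc X (π^[n] ℓ) → j ∈ prefixOcc X (π^[n] ℓ) →
    π^[n] (t + 1) - π^[n] t ≤ C * (j - i)

theorem PrimitiveInflation.gap_of_range_eq (h : PrimitiveInflation X π) {ℓ : ℕ} {o : ℕ → ℕ}
    (ho : StrictMono o) (hr : Set.range o = prefixOcc X ℓ) : ∃ g, ∀ k, o (k + 1) ≤ o k + g := by
  obtain ⟨g, hg⟩ := h.exists_occ_gap ℓ
  refine ⟨g, fun k => ?_⟩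
  obtain ⟨i, hi, h1, h2⟩ := hg (o k)
  rw [← hr] at hi
  obtain ⟨k', rfl⟩ := hi
  have := ho.lt_iff_lt.1 h1
  exact (ho.monotone this).trans h2

theorem Inflation.factor_congr (h : Inflation X π) {a b a' b' : ℕ} (hab : a ≤ b) (hab' : a' ≤ b')
    (hf : factor X a b = factor X a' b') :
    factor X (π a) (π b) = factor X (π a') (π b') := by
  obtain ⟨h1, h2⟩ := factor_eq_iff.1 hf
  have h3 := h.sameWord h2
  have h4 := h.gap_of_sameWord h2 _ le_rfl
  rw [Nat.add_sub_cancel' hab] at h3 h4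
  rw [h1, Nat.add_sub_cancel' hab'] at h4
  have m1 := h.strictMono.monotone hab
  have m2 := h.strictMono.monotone hab'
  exact factor_eq_iff.2 ⟨by omega, h3⟩

/-- Raising the level to `n₁` makes `π` map occurrences onto occurrences. From there inflation can
only identify return words, so their number is nonincreasing; at a level `n₂` where it is least, no
two are identified later. -/
theorem PrimitiveInflation.exists_returnCoding (h : PrimitiveInflation X π) :
    ∃ ℓ o, ReturnCoding X π ℓ o := by
  obtain ⟨ℓ₁, C, -, hsep⟩ := h.exists_separation
  obtain ⟨n₁, hn₁⟩ := h.exists_occ_stable (hsep (ℓ₁ + 1) (Nat.le_succ _))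
  have hit : ∀ n m x, π^[n] (π^[m] x) = π^[n + m] x := fun n m x =>
    (Function.iterate_add_apply π n m x).symm
  have hocc : ∀ n, n₁ ≤ n →
      π '' prefixOcc X (π^[n] (ℓ₁ + 1)) = prefixOcc X (π^[n + 1] (ℓ₁ + 1)) := by
    intro n hn
    refine Set.Subset.antisymm ?_ (hn₁ n hn)
    rintro _ ⟨i, hi, rfl⟩
    rw [Function.iterate_succ_apply']
    exact h.mem_prefixOcc hi
  set ℓ₂ := π^[n₁] (ℓ₁ + 1) with hℓ₂
  have hocc₂ : ∀ n, π^[n] '' prefixOcc X ℓ₂ = prefixOcc X (π^[n] ℓ₂) := by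
    intro n
    induction n with
    | zero => simp
    | succ n ih =>
      rw [Function.iterate_succ', Set.image_comp, ih, hℓ₂, hit, hocc _ (by omega),
        Function.comp_apply, hit, ← Function.iterate_succ_apply' π]
  have hinf : (prefixOcc X ℓ₂).Infinite := by
    obtain ⟨g, hg⟩ := h.exists_occ_gap ℓ₂
    refine Set.infinite_of_not_bddAbove ?_
    rintro ⟨b, hb⟩
    obtain ⟨i, hi, h1, -⟩ := hg b
    exact absurd (hb hi) (not_le.2 h1)
  classical
  set o : ℕ → ℕ := Nat.nth (· ∈ prefixOcc X ℓ₂) with ho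
  have hmono : StrictMono o := Nat.nth_strictMono hinf
  have hrange : Set.range o = prefixOcc X ℓ₂ := Nat.range_nth_of_infinite hinf
  have hrange_n : ∀ n, Set.range (fun k => π^[n] (o k)) = prefixOcc X (π^[n] ℓ₂) := by
    intro n
    rw [← hocc₂ n, ← hrange, ← Set.range_comp]
    rfl
  set w : ℕ → ℕ → List L := fun n k => factor X (π^[n] (o k)) (π^[n] (o (k + 1))) with hw
  have hm : ∀ n k, π^[n] (o k) ≤ π^[n] (o (k + 1)) := fun n k =>
    (h.toInflation.iterate n).strictMono.monotone (hmono.monotone (Nat.le_succ k))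
  have hwcongr : ∀ n m k k', w n k = w n k' → w (m + n) k = w (m + n) k' := by
    intro n m k k' hk
    have := (h.toInflation.iterate m).factor_congr (hm n k) (hm n k') hk
    simpa only [hit] using this
  have hfin : ∀ n, (Set.range (w n)).Finite := by
    intro n
    have hs : StrictMono fun k => π^[n] (o k) := (h.toInflation.iterate n).strictMono.comp hmono
    obtain ⟨g, hg⟩ := h.gap_of_range_eq hs (hrange_n n)
    exact finite_range_factor h.finite hg
  set κ : ℕ → ℕ := fun n => (Set.range (w n)).ncard
  set n₂ := Function.argmin κ
  have hmin : ∀ n, κ n₂ ≤ κ n := fun n => Function.argmin_le κ n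
  have hinj : ∀ m k k', w (m + n₂) k = w (m + n₂) k' → w n₂ k = w n₂ k' := by
    intro m k k' hk
    have hex : ∀ a ∈ Set.range (w n₂), ∃ s, w n₂ s = a := fun a ha => ha
    choose! s hs using hex
    set φ : List L → List L := fun a => w (m + n₂) (s a)
    have hφ : ∀ k, φ (w n₂ k) = w (m + n₂) k := fun k => hwcongr _ _ _ _ (hs _ ⟨k, rfl⟩)
    have himg : φ '' Set.range (w n₂) = Set.range (w (m + n₂)) := by
      rw [← Set.range_comp]
      exact congrArg Set.range (funext hφ)
    have hcard : (φ '' Set.range (w n₂)).ncard = (Set.range (w n₂)).ncard := by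
      apply le_antisymm (Set.ncard_image_le (hfin _))
      rw [himg]
      exact hmin _
    refine Set.injOn_of_ncard_image_eq hcard (hfin _) ⟨k, rfl⟩ ⟨k', rfl⟩ ?_
    rw [hφ, hφ, hk]
  have hs : StrictMono fun k => π^[n₂] (o k) := (h.toInflation.iterate n₂).strictMono.comp hmono
  refine ⟨π^[n₂] ℓ₂, fun k => π^[n₂] (o k), ?_, hs, ?_, ?_, h.gap_of_range_eq hs (hrange_n _),
    C, ?_⟩
  · have a1 := h.add_le_iterate n₁ (i := ℓ₁ + 1) (Nat.succ_pos ℓ₁)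
    have a2 := h.add_le_iterate n₂ (i := ℓ₂) (by omega)
    omega
  · intro n
    simp only [hit]
    exact hrange_n _
  · intro n k k' hk
    simp only [hit] at hk
    exact hinj n k k' hk
  · intro n i j t hij hi hj
    refine hsep ℓ₂ ?_ n i j t hij (prefixOcc_anti ?_ hi) (prefixOcc_anti ?_ hj)
    · have := h.add_le_iterate n₁ (i := ℓ₁ + 1) (Nat.succ_pos ℓ₁)
      omega
    all_goals
      apply (h.toInflation.iterate n).strictMono.monotone
      have hp : 0 < ℓ₂ := by
        have := h.add_le_iterate n₁ (i := ℓ₁ + 1) (Nat.succ_pos ℓ₁)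
        omega
      have := h.add_le_iterate n₂ hp
      omega

end ReturnWords

/-! ### Label counts and transfer maps between return words of different prefixes. -/

section Counting

variable {R R' R'' : Type*} [Fintype R] [DecidableEq R] [Fintype R'] [DecidableEq R']
  [Fintype R''] [DecidableEq R'']

/-- The number of occurrences of each letter in the prefix of length `k` of `D`. -/
noncomputable def letterCount (D : ℕ → R) (k : ℕ) : R → ℂ :=
  ∑ i ∈ Finset.range k, Pi.single (D i) 1

omit [Fintype R] in
theorem letterCount_zero (D : ℕ → R) : letterCount D 0 = 0 := by simp [letterCount]

omit [Fintype R] in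
theorem letterCount_succ (D : ℕ → R) (k : ℕ) :
    letterCount D (k + 1) = letterCount D k + Pi.single (D k) 1 := by
  simp [letterCount, Finset.sum_range_succ]

/-- The increment of `H` at `k` depends only on the label `D k`; `P` sends each basis vector to the
increment of its label. -/
theorem exists_linearMap_letterCount {D : ℕ → R} (hD : Function.Surjective D) {V : Type*}
    [AddCommGroup V] [Module ℂ V] (H : ℕ → V) (h0 : H 0 = 0)
    (hH : ∀ k k', D k = D k' → H (k + 1) - H k = H (k' + 1) - H k') :
    ∃ P : (R → ℂ) →ₗ[ℂ] V, ∀ k, P (letterCount D k) = H k := by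
  choose s hs using hD
  refine ⟨(Pi.basisFun ℂ R).constr ℂ fun r => H (s r + 1) - H (s r), fun k => ?_⟩
  induction k with
  | zero => simp [letterCount_zero, h0]
  | succ k ih =>
    have := (Pi.basisFun ℂ R).constr_basis ℂ (fun r => H (s r + 1) - H (s r)) (D k)
    rw [Pi.basisFun_apply] at this
    rw [letterCount_succ, map_add, ih, this, hH _ k (hs _)]
    abel

theorem linearMap_ext_letterCount {D : ℕ → R} (hD : Function.Surjective D) {V : Type*}
    [AddCommGroup V] [Module ℂ V] {P Q : (R → ℂ) →ₗ[ℂ] V}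
    (h : ∀ k, P (letterCount D k) = Q (letterCount D k)) : P = Q := by
  apply (Pi.basisFun ℂ R).ext
  intro r
  obtain ⟨k, rfl⟩ := hD r
  have h1 := h (k + 1)
  rw [letterCount_succ, map_add, map_add, h k] at h1
  simpa using h1

/-- For subsequences `q` and `q'` of positions labelled by `D` and `D'`, the map `P` sends the
label count of `q'` up to a position to the label count of `q` up to the same position. -/
def IsTransfer (q : ℕ → ℕ) (D : ℕ → R) (q' : ℕ → ℕ) (D' : ℕ → R')
    (P : (R' → ℂ) →ₗ[ℂ] (R → ℂ)) : Prop :=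
  ∀ k k', q k = q' k' → P (letterCount D' k') = letterCount D k

omit [Fintype R] [Fintype R'] in
theorem IsTransfer.comp_left {q q' : ℕ → ℕ} {D : ℕ → R} {D' : ℕ → R'}
    {P : (R' → ℂ) →ₗ[ℂ] (R → ℂ)} (h : IsTransfer q D q' D' P) {f : ℕ → ℕ}
    (hf : Function.Injective f) : IsTransfer (f ∘ q) D (f ∘ q') D' P :=
  fun k k' hk => h k k' (hf hk)

omit [Fintype R] [Fintype R'] [Fintype R''] in
theorem IsTransfer.comp {q q' q'' : ℕ → ℕ} {D : ℕ → R} {D' : ℕ → R'} {D'' : ℕ → R''}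
    {P : (R' → ℂ) →ₗ[ℂ] (R → ℂ)} {Q : (R'' → ℂ) →ₗ[ℂ] (R' → ℂ)}
    (h : IsTransfer q D q' D' P) (h' : IsTransfer q' D' q'' D'' Q)
    (hr : Set.range q'' ⊆ Set.range q') : IsTransfer q D q'' D'' (P ∘ₗ Q) := by
  intro k k'' hk
  obtain ⟨k', hk'⟩ := hr ⟨k'', rfl⟩
  rw [LinearMap.comp_apply, h' k' k'' hk', h k k' (hk.trans hk'.symm)]

omit [Fintype R] in
theorem IsTransfer.unique {q q' : ℕ → ℕ} {D : ℕ → R} {D' : ℕ → R'}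
    {P Q : (R' → ℂ) →ₗ[ℂ] (R → ℂ)} (h : IsTransfer q D q' D' P) (h' : IsTransfer q D q' D' Q)
    (hD' : Function.Surjective D') (hr : Set.range q' ⊆ Set.range q) : P = Q := by
  apply linearMap_ext_letterCount hD'
  intro k'
  obtain ⟨k, hk⟩ := hr ⟨k', rfl⟩
  rw [h k k' hk, h' k k' hk]

omit [Fintype R] in
theorem isTransfer_id {q : ℕ → ℕ} (hq : Function.Injective q) (D : ℕ → R) :
    IsTransfer q D q D LinearMap.id := by
  intro k k' hk
  rw [hq hk, LinearMap.id_apply]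

/-- The indicator of the positions `q k`, with value the basis vector of the label `D k`. -/
noncomputable def labelAt (q : ℕ → ℕ) (D : ℕ → R) : ℕ → R → ℂ :=
  Function.extend q (fun k => Pi.single (D k) 1) 0

/-- The number of positions `q k < j` with each label. -/
noncomputable def labelCount (q : ℕ → ℕ) (D : ℕ → R) (j : ℕ) : R → ℂ :=
  ∑ t ∈ Finset.range j, labelAt q D t

omit [Fintype R] in
theorem labelCount_add (q : ℕ → ℕ) (D : ℕ → R) (i d : ℕ) :
    labelCount q D (i + d) = labelCount q D i + ∑ t ∈ Finset.range d, labelAt q D (i + t) :=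
  Finset.sum_range_add _ _ _

theorem norm_labelAt_le (q : ℕ → ℕ) (hq : Function.Injective q) (D : ℕ → R) (t : ℕ) :
    ‖labelAt q D t‖ ≤ 1 := by
  rw [labelAt]
  by_cases h : ∃ k, q k = t
  · obtain ⟨k, rfl⟩ := h
    rw [hq.extend_apply, pi_norm_le_iff_of_nonneg zero_le_one]
    intro r
    rw [Pi.single_apply]
    split_ifs <;> simp
  · rw [Function.extend_apply' _ _ _ h]
    simp

omit [Fintype R] in
theorem labelCount_apply {q : ℕ → ℕ} (hq : StrictMono q) (h0 : q 0 = 0) (D : ℕ → R) (k : ℕ) :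
    labelCount q D (q k) = letterCount D k := by
  induction k with
  | zero => simp [h0, labelCount, letterCount]
  | succ k ih =>
    have hk := hq (Nat.lt_succ_self k)
    obtain ⟨d, hd⟩ := Nat.exists_eq_add_of_lt hk
    rw [Nat.succ_eq_add_one] at hd
    rw [hd, add_assoc, labelCount_add, ih, letterCount_succ, Finset.sum_range_succ',
      Finset.sum_eq_zero, zero_add, add_zero, labelAt, hq.injective.extend_apply]
    intro t ht
    rw [Finset.mem_range] at ht
    rw [labelAt, Function.extend_apply']
    · rfl
    rintro ⟨k', hk'⟩
    have h1 : k < k' := hq.lt_iff_lt.1 (by omega)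
    have h2 : k' < k + 1 := hq.lt_iff_lt.1 (by omega)
    omega

variable {L : Type*} {X : ℕ → L}

omit [Fintype R] in
/-- The labels of the occurrences of a prefix are determined locally. -/
theorem labelAt_congr {q : ℕ → ℕ} (hq : StrictMono q) {ℓ : ℕ} (hr : Set.range q = prefixOcc X ℓ)
    {D : ℕ → R} (hD : ∀ k k', factor X (q k) (q (k + 1)) = factor X (q k') (q (k' + 1)) →
      D k = D k') {i i' d t : ℕ} (hw : SameWord X i i' (d + ℓ)) (hi : i + d ∈ prefixOcc X ℓ)
    (ht : t < d) : labelAt q D (i + t) = labelAt q D (i' + t) := by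
  have hocc : ∀ s ≤ d, (i + s ∈ Set.range q ↔ i' + s ∈ Set.range q) := fun s hs => by
    rw [hr]
    exact mem_prefixOcc_iff_of_sameWord (hw.shift (by omega))
  by_cases hit : i + t ∈ Set.range q
  · have hit' := (hocc t ht.le).1 hit
    obtain ⟨k, hk⟩ := hit
    obtain ⟨k', hk'⟩ := hit'
    rw [← hk, ← hk', labelAt, hq.injective.extend_apply, hq.injective.extend_apply]
    have next : ∀ {j s}, q j < s → s ∈ Set.range q → q (j + 1) ≤ s := by
      rintro j _ hj ⟨m, rfl⟩
      exact hq.monotone (hq.lt_iff_lt.1 hj)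
    have m1 := hq (Nat.lt_succ_self k)
    have m2 := hq (Nat.lt_succ_self k')
    rw [Nat.succ_eq_add_one] at m1 m2
    -- The occurrence at `i + d` closes the return word inside the window. Occurrences match offset
    -- by offset, so the next one comes at the same distance on both sides.
    have n1 : q (k + 1) ≤ i + d := next (by omega) (hr ▸ hi)
    have n2 : q (k' + 1) ≤ i' + (q (k + 1) - i) := by
      apply next (by omega)
      rw [← hocc _ (by omega), Nat.add_sub_cancel' (by omega)]
      exact ⟨_, rfl⟩
    have n3 : q (k + 1) ≤ i + (q (k' + 1) - i') := by
      apply next (by omega)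
      rw [hocc _ (by omega), Nat.add_sub_cancel' (by omega)]
      exact ⟨_, rfl⟩
    rw [hD k k']
    rw [factor_eq_iff, hk, hk']
    exact ⟨by omega, hw.shift (by omega)⟩
  · have hit' := fun h => hit ((hocc t ht.le).2 h)
    rw [labelAt, Function.extend_apply' _ _ _ hit, Function.extend_apply' _ _ _ hit']
    rfl

omit [Fintype R] in
theorem labelCount_sub_congr {q : ℕ → ℕ} (hq : StrictMono q) {ℓ : ℕ}
    (hr : Set.range q = prefixOcc X ℓ)
    {D : ℕ → R} (hD : ∀ k k', factor X (q k) (q (k + 1)) = factor X (q k') (q (k' + 1)) →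
      D k = D k') {i i' d : ℕ} (hw : SameWord X i i' d) (hi : i + d ∈ prefixOcc X ℓ)
    (hi' : i' + d ∈ prefixOcc X ℓ) : labelCount q D (i + d) - labelCount q D i =
      labelCount q D (i' + d) - labelCount q D i' := by
  rw [labelCount_add, labelCount_add, add_sub_cancel_left, add_sub_cancel_left]
  refine Finset.sum_congr rfl fun t ht => ?_
  exact labelAt_congr hq hr hD (hw.extend hi hi') hi (Finset.mem_range.1 ht)

omit [Fintype R] in
/-- Transfer maps exist from the return words of a prefix to those of a shorter one. -/
theorem exists_isTransfer {q q' : ℕ → ℕ} (hq : StrictMono q) (hq' : StrictMono q') {ℓ ℓ' : ℕ}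
    (hr : Set.range q = prefixOcc X ℓ) (hr' : Set.range q' = prefixOcc X ℓ') (hℓ : ℓ ≤ ℓ')
    {D : ℕ → R} (hD : ∀ k k', factor X (q k) (q (k + 1)) = factor X (q k') (q (k' + 1)) →
      D k = D k')
    {D' : ℕ → R'} (hD's : Function.Surjective D') (hD' : ∀ k k', D' k = D' k' →
      factor X (q' k) (q' (k + 1)) = factor X (q' k') (q' (k' + 1))) :
    ∃ P, IsTransfer q D q' D' P := by
  have zero : ∀ {q : ℕ → ℕ} {ℓ}, StrictMono q → Set.range q = prefixOcc X ℓ → q 0 = 0 := by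
    intro q ℓ hq hr
    obtain ⟨k, hk⟩ : 0 ∈ Set.range q := hr ▸ zero_mem_prefixOcc ℓ
    have := hq.monotone (Nat.zero_le k)
    omega
  have hsub : ∀ k, q' k ∈ prefixOcc X ℓ := fun k =>
    prefixOcc_anti hℓ (hr' ▸ ⟨k, rfl⟩)
  obtain ⟨P, hP⟩ := exists_linearMap_letterCount hD's (fun k' => labelCount q D (q' k'))
    (by simp [zero hq' hr', labelCount]) (fun k k' hk => by
      obtain ⟨e1, e2⟩ := factor_eq_iff.1 (hD' k k' hk)
      have m1 := hq'.monotone (Nat.le_succ k)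
      have m2 := hq'.monotone (Nat.le_succ k')
      rw [Nat.succ_eq_add_one] at m1 m2
      have a1 : q' k + (q' (k + 1) - q' k) = q' (k + 1) := Nat.add_sub_cancel' m1
      have a2 : q' k' + (q' (k + 1) - q' k) = q' (k' + 1) := by omega
      have := labelCount_sub_congr hq hr hD e2 (by rw [a1]; exact hsub _)
        (by rw [a2]; exact hsub _)
      rwa [a1, a2] at this)
  refine ⟨P, fun k k' hk => ?_⟩
  rw [hP]
  simp only [← hk]
  exact labelCount_apply hq (zero hq hr) D k

omit [Fintype R] [Fintype R'] in
/-- The matrix of a transfer map has bounded natural entries. -/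
theorem IsTransfer.exists_natCast {q q' : ℕ → ℕ} (hq : StrictMono q) {D : ℕ → R} {D' : ℕ → R'}
    {P : (R' → ℂ) →ₗ[ℂ] (R → ℂ)} (h : IsTransfer q D q' D' P)
    (hr : Set.range q' ⊆ Set.range q) {C E B : ℕ} (hE : 0 < E)
    (hsep : ∀ c, E ≤ C * (q (c + 1) - q c)) (k' : ℕ) (hm : q' k' ≤ q' (k' + 1))
    (hB : C * (q' (k' + 1) - q' k') ≤ B * E) (r : R) :
    ∃ N ≤ B, P (Pi.single (D' k') 1) r = (N : ℂ) := by
  obtain ⟨a, ha⟩ := hr ⟨k', rfl⟩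
  obtain ⟨b, hb⟩ := hr ⟨k' + 1, rfl⟩
  have h1 : P (Pi.single (D' k') 1) = letterCount D b - letterCount D a := by
    rw [← h a k' ha, ← h b _ hb, letterCount_succ, map_add, add_sub_cancel_left]
  have hab : a ≤ b := hq.le_iff_le.1 (by omega)
  obtain ⟨d, rfl⟩ := Nat.exists_eq_add_of_le hab
  -- The return word of `q'` is a concatenation of `d` return words of `q`, each of length at least
  -- `E / C`.
  have hd : d ≤ B := by
    have : ∀ e, e * E ≤ C * (q (a + e) - q a) := by
      intro e
      induction e with
      | zero => simp
      | succ e ih =>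
        have h2 := hsep (a + e)
        have h3 := hq.monotone (Nat.le_add_right a e)
        have h4 := hq.monotone (Nat.le_succ (a + e))
        rw [Nat.succ_eq_add_one] at h4
        rw [← add_assoc, show q (a + e + 1) - q a = (q (a + e) - q a) +
          (q (a + e + 1) - q (a + e)) by omega, mul_add, add_mul]
        omega
    have h2 := this d
    rw [ha, hb] at h2
    exact Nat.le_of_mul_le_mul_right (h2.trans hB) hE
  refine ⟨((Finset.range d).filter fun i => D (a + i) = r).card,
    (Finset.card_filter_le _ _).trans (by simpa using hd), ?_⟩
  rw [h1, letterCount, letterCount, Finset.sum_range_add, add_sub_cancel_left, Finset.sum_apply,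
    Finset.card_filter, Nat.cast_sum]
  refine Finset.sum_congr rfl fun i _ => ?_
  rw [Pi.single_apply]
  simp [eq_comm]

end Counting

/-! ### Eigenvalues of intertwined endomorphisms. -/

section Eigenvalues

variable {V W : Type*} [AddCommGroup V] [Module ℂ V] [FiniteDimensional ℂ V]
  [AddCommGroup W] [Module ℂ W] [FiniteDimensional ℂ W]

omit [FiniteDimensional ℂ V] in
theorem hasEigenvalue_iff_exists {f : Module.End ℂ V} {μ : ℂ} :
    f.HasEigenvalue μ ↔ ∃ v, v ≠ 0 ∧ f v = μ • v := by
  constructor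
  · intro h
    obtain ⟨v, hv⟩ := h.exists_hasEigenvector
    exact ⟨v, hv.2, hv.apply_eq_smul⟩
  · rintro ⟨v, h0, h⟩
    exact Module.End.hasEigenvalue_of_hasEigenvector
      ⟨Module.End.mem_eigenspace_iff.2 h, h0⟩

/-- In finite dimension, `f - μ` is not injective exactly when its range is proper, that is, killed
by a nonzero functional. Functionals can be pulled back along an intertwiner. -/
theorem hasEigenvalue_iff_exists_dual {f : Module.End ℂ V} {μ : ℂ} :
    f.HasEigenvalue μ ↔ ∃ z : V →ₗ[ℂ] ℂ, z ≠ 0 ∧ ∀ v, z (f v) = μ * z v := by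
  have key : f.HasEigenvalue μ ↔ ¬ Function.Injective (f - algebraMap ℂ (Module.End ℂ V) μ) := by
    rw [← LinearMap.ker_eq_bot, Module.End.hasEigenvalue_iff, Module.End.eigenspace_def]
    rfl
  rw [key]
  constructor
  · intro h
    have h' : LinearMap.range (f - algebraMap ℂ (Module.End ℂ V) μ) < ⊤ := by
      rw [lt_top_iff_ne_top, Ne, LinearMap.range_eq_top, ← LinearMap.injective_iff_surjective]
      exact h
    obtain ⟨z, hz, hle⟩ := Submodule.exists_le_ker_of_lt_top _ h'
    refine ⟨z, hz, fun v => ?_⟩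
    have := hle ⟨v, rfl⟩
    rw [LinearMap.mem_ker, LinearMap.sub_apply, map_sub, sub_eq_zero] at this
    rw [this]
    simp [Module.algebraMap_end_apply]
  · rintro ⟨z, hz, h⟩ hinj
    apply hz
    ext v
    obtain ⟨w, rfl⟩ := LinearMap.injective_iff_surjective.1 hinj v
    simp [Module.algebraMap_end_apply, h]

omit [FiniteDimensional ℂ V] in
theorem pow_apply_eq_smul {f : Module.End ℂ V} {μ : ℂ} {v : V} (h : f v = μ • v) (n : ℕ) :
    (f ^ n) v = μ ^ n • v := by
  induction n with
  | zero => simp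
  | succ n ih => rw [pow_succ, Module.End.mul_apply, h, map_smul, ih, smul_smul, pow_succ']

omit [FiniteDimensional ℂ V] in
theorem dual_pow_apply {f : Module.End ℂ V} {μ : ℂ} {z : V →ₗ[ℂ] ℂ}
    (h : ∀ v, z (f v) = μ * z v) (n : ℕ) (v : V) : z ((f ^ n) v) = μ ^ n * z v := by
  induction n with
  | zero => simp
  | succ n ih => rw [pow_succ', Module.End.mul_apply, h, ih, pow_succ', mul_assoc]

/-- Intertwined powers have the same nonzero eigenvalues, when the intertwiner divides powers of
both endomorphisms. -/
theorem hasEigenvalue_pow_iff_of_intertwine {S : Module.End ℂ V} {T : Module.End ℂ W}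
    {P : W →ₗ[ℂ] V} {Q Q' : V →ₗ[ℂ] W} {p q a b : ℕ} (hp : 0 < p) (hq : 0 < q)
    (hP : (S ^ p) ∘ₗ P = P ∘ₗ (T ^ q)) (hQ : P ∘ₗ Q = S ^ a) (hQ' : Q' ∘ₗ P = T ^ b)
    {μ : ℂ} (hμ : μ ≠ 0) : (S ^ p).HasEigenvalue μ ↔ (T ^ q).HasEigenvalue μ := by
  have hpow : ∀ {p a : ℕ}, 0 < p → p * a = (p - 1) * a + a := fun {p a} hp => by
    obtain ⟨p, rfl⟩ := Nat.exists_eq_add_of_lt hp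
    simp [add_mul]
  constructor
  · rw [hasEigenvalue_iff_exists_dual, hasEigenvalue_iff_exists_dual]
    rintro ⟨z, hz, h⟩
    -- If `z ∘ P = 0` then `z` kills the range of `S ^ a = P ∘ Q`, hence that of `(S ^ p) ^ a`, on
    -- which it acts by `μ ^ a ≠ 0`.
    refine ⟨z ∘ₗ P, fun h0 => hz ?_, fun v => ?_⟩
    · ext v
      have h1 := dual_pow_apply h a v
      have h2 : (S ^ p) ^ a = S ^ a * S ^ ((p - 1) * a) := by
        rw [← pow_mul, ← pow_add, hpow hp, add_comm]
      rw [h2, Module.End.mul_apply, ← hQ, LinearMap.comp_apply, ← LinearMap.comp_apply, h0] at h1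
      have := mul_eq_zero.1 h1.symm
      exact this.resolve_left (pow_ne_zero _ hμ)
    · have := LinearMap.congr_fun hP v
      simp only [LinearMap.comp_apply] at this ⊢
      rw [← this, h]
  · rw [hasEigenvalue_iff_exists, hasEigenvalue_iff_exists]
    rintro ⟨y, hy, h⟩
    refine ⟨P y, fun h0 => hy ?_, ?_⟩
    · have h1 := pow_apply_eq_smul h b
      have h2 : (T ^ q) ^ b = T ^ ((q - 1) * b) * T ^ b := by
        rw [← pow_mul, ← pow_add, hpow hq]
      rw [h2, Module.End.mul_apply, ← hQ', LinearMap.comp_apply, h0, map_zero, map_zero] at h1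
      exact (smul_eq_zero.1 h1.symm).resolve_left (pow_ne_zero _ hμ)
    · have := LinearMap.congr_fun hP y
      simp only [LinearMap.comp_apply] at this
      rw [this, h, map_smul]

theorem eq_zero_of_bounded_mul_pow {μ : ℂ} (hμ : 1 < ‖μ‖) {c B : ℝ} (hc : 0 ≤ c)
    (h : ∀ n : ℕ, ‖μ‖ ^ n * c ≤ B) : c = 0 := by
  by_contra hne
  have hpos : 0 < c := lt_of_le_of_ne hc (Ne.symm hne)
  obtain ⟨n, hn⟩ := pow_unbounded_of_one_lt (B / c) hμ
  rw [div_lt_iff₀ hpos] at hn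
  exact absurd (h n) (not_le.2 hn)

end Eigenvalues

/-! ### Comparing the two return substitutions, and return words with letters. -/

section Coding

variable {L : Type*} {X : ℕ → L} {π ρ : ℕ → ℕ}
  {R R' A : Type*} [Fintype R] [DecidableEq R] [Fintype R'] [DecidableEq R']
  [Fintype A] [DecidableEq A]

theorem ReturnCoding.range_comp {ℓ : ℕ} {o : ℕ → ℕ} (c : ReturnCoding X π ℓ o) (n : ℕ) :
    Set.range (π^[n] ∘ o) = prefixOcc X (π^[n] ℓ) := c.range_eq n

theorem ReturnCoding.apply_zero {ℓ : ℕ} {o : ℕ → ℕ} (c : ReturnCoding X π ℓ o) : o 0 = 0 := by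
  obtain ⟨k, hk⟩ : 0 ∈ Set.range o := (c.range_eq 0) ▸ zero_mem_prefixOcc ℓ
  have := c.strictMono.monotone (Nat.zero_le k)
  omega

theorem PrimitiveInflation.strictMono_iterate_apply (h : PrimitiveInflation X π) {ℓ : ℕ} (hℓ : 0 < ℓ) :
    StrictMono fun n => π^[n] ℓ := by
  refine strictMono_nat_of_lt_succ fun n => ?_
  rw [Function.iterate_succ_apply']
  have := h.add_le_iterate n hℓ
  exact h.lt_apply (by omega)

theorem ReturnCoding.range_subset (h : PrimitiveInflation X π) {ℓ : ℕ} {o : ℕ → ℕ}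
    (c : ReturnCoding X π ℓ o) {n m : ℕ} (hnm : n ≤ m) :
    Set.range (π^[m] ∘ o) ⊆ Set.range (π^[n] ∘ o) := by
  rw [c.range_comp, c.range_comp]
  exact prefixOcc_anti ((h.strictMono_iterate_apply c.pos).monotone hnm)

omit [Fintype R] in
-- Injectivity of `π^[n]` carries `hS` to every level, so the same matrix `S` passes between any two
-- consecutive levels.
theorem ReturnCoding.isTransfer_pow (h : PrimitiveInflation X π) {ℓ : ℕ} {o : ℕ → ℕ}
    (c : ReturnCoding X π ℓ o) {D : ℕ → R} {S : Module.End ℂ (R → ℂ)}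
    (hS : IsTransfer o D (π ∘ o) D S) (n j : ℕ) :
    IsTransfer (π^[n] ∘ o) D (π^[n + j] ∘ o) D (S ^ j) := by
  induction j with
  | zero => exact isTransfer_id ((h.toInflation.iterate n).strictMono.comp c.strictMono).injective D
  | succ j ih =>
    rw [pow_succ, Module.End.mul_eq_comp]
    refine ih.comp (q'' := π^[n + (j + 1)] ∘ o) ?_ (c.range_subset h (by omega))
    have := hS.comp_left (h.toInflation.iterate (n + j)).strictMono.injective
    rwa [← Function.comp_assoc, ← Function.iterate_succ] at this

/-- Inflated prefixes for two inflations of the same sequence can be chosen of comparable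
lengths. -/
theorem exists_comparable_level (h : PrimitiveInflation X π) (h' : PrimitiveInflation X ρ)
    {ℓ ℓ' : ℕ} (hℓ' : 0 < ℓ') :
    ∃ K, ∀ n, ∃ m, π^[n] ℓ ≤ ρ^[m] ℓ' ∧ ∀ t, ρ^[m] (t + 1) ≤ ρ^[m] t + K * π^[n] 1 := by
  classical
  obtain ⟨C, -, hC⟩ := h.exists_gap_ratio
  obtain ⟨C', -, hC'⟩ := h'.exists_gap_ratio
  obtain ⟨K₁, hK₁⟩ := h'.toInflation.exists_gap_bound h'.finite
  refine ⟨K₁ * (C' * (ℓ * C)) + 1, fun n => ?_⟩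
  have hex : ∃ m, π^[n] ℓ ≤ ρ^[m] ℓ' :=
    ⟨π^[n] ℓ, by have := h'.add_le_iterate (π^[n] ℓ) hℓ'; omega⟩
  -- Minimality of the level bounds `ρ^[m] 1` one step earlier by a multiple of `π^[n] 1`; the last
  -- step costs a bounded factor. The `+ 1` in the constant covers level zero.
  refine ⟨Nat.find hex, Nat.find_spec hex, fun t => ?_⟩
  have hpos := h.add_le_iterate n one_pos
  rcases Nat.eq_zero_or_pos (Nat.find hex) with h0 | hp
  · rw [h0, add_mul]
    simp only [Function.iterate_zero, id]
    omega
  · obtain ⟨m, hm⟩ := Nat.exists_eq_add_of_lt hp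
    rw [zero_add] at hm
    have hlt := Nat.find_min hex (m := m) (by omega)
    rw [hm]
    have im := h'.toInflation.iterate m
    have iπ := h.toInflation.iterate n
    have b1 : ρ^[m] 1 ≤ π^[n] ℓ :=
      (im.strictMono.monotone (show 1 ≤ ℓ' from hℓ')).trans (not_le.1 hlt).le
    have b2 : π^[n] ℓ ≤ ℓ * (C * π^[n] 1) := by
      have := Nat.le_add_mul_of_gap (f := π^[n]) (K := C * π^[n] 1) (fun i => by
        have := hC n i 0
        simp only [zero_add, iπ.zero, Nat.sub_zero] at this
        omega) 0 ℓ
      simpa [iπ.zero] using this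
    have b3 : ∀ i, ρ^[m] (i + 1) ≤ ρ^[m] i + C' * ρ^[m] 1 := fun i => by
      have := hC' m i 0
      simp only [zero_add, im.zero, Nat.sub_zero] at this
      omega
    rw [Function.iterate_succ_apply, Function.iterate_succ_apply]
    calc ρ^[m] (ρ (t + 1)) ≤ ρ^[m] (ρ t + K₁) := im.strictMono.monotone (hK₁ t)
      _ ≤ ρ^[m] (ρ t) + K₁ * (C' * ρ^[m] 1) := Nat.le_add_mul_of_gap b3 _ _
      _ ≤ ρ^[m] (ρ t) + K₁ * (C' * (ℓ * (C * π^[n] 1))) := by gcongr; exact b1.trans b2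
      _ = ρ^[m] (ρ t) + K₁ * (C' * (ℓ * C)) * π^[n] 1 := by ring
      _ ≤ _ := by gcongr; omega

/-- The return substitutions of two inflations of the same sequence have powers with the same
nonzero eigenvalues. -/
theorem exists_pow_hasEigenvalue_iff (h : PrimitiveInflation X π) (h' : PrimitiveInflation X ρ)
    {ℓ ℓ' : ℕ} {o o' : ℕ → ℕ} (c : ReturnCoding X π ℓ o) (c' : ReturnCoding X ρ ℓ' o')
    {D : ℕ → R} (hDs : Function.Surjective D)
    (hD : ∀ k k', D k = D k' ↔ factor X (o k) (o (k + 1)) = factor X (o k') (o (k' + 1)))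
    {D' : ℕ → R'} (hDs' : Function.Surjective D')
    (hD' : ∀ k k', D' k = D' k' ↔ factor X (o' k) (o' (k + 1)) = factor X (o' k') (o' (k' + 1)))
    {S : Module.End ℂ (R → ℂ)} (hS : IsTransfer o D (π ∘ o) D S)
    {T : Module.End ℂ (R' → ℂ)} (hT : IsTransfer o' D' (ρ ∘ o') D' T) :
    ∃ p q : ℕ, 0 < p ∧ 0 < q ∧ ∀ μ : ℂ, μ ≠ 0 →
      ((S ^ p).HasEigenvalue μ ↔ (T ^ q).HasEigenvalue μ) := by
  obtain ⟨K, hK⟩ := exists_comparable_level h h' (ℓ := ℓ) c'.pos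
  choose m hm1 hm2 using hK
  obtain ⟨C, hC⟩ := c.sep
  obtain ⟨g, hg⟩ := c'.gap
  have mo : ∀ n, StrictMono (π^[n] ∘ o) := fun n =>
    (h.toInflation.iterate n).strictMono.comp c.strictMono
  have mo' : ∀ n, StrictMono (ρ^[n] ∘ o') := fun n =>
    (h'.toInflation.iterate n).strictMono.comp c'.strictMono
  have f1 : ∀ n k k', factor X ((π^[n] ∘ o) k) ((π^[n] ∘ o) (k + 1)) =
      factor X ((π^[n] ∘ o) k') ((π^[n] ∘ o) (k' + 1)) → D k = D k' := fun n k k' hk =>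
    (hD k k').2 (c.factor_inj n k k' hk)
  have f1' : ∀ n k k', factor X ((ρ^[n] ∘ o') k) ((ρ^[n] ∘ o') (k + 1)) =
      factor X ((ρ^[n] ∘ o') k') ((ρ^[n] ∘ o') (k' + 1)) → D' k = D' k' := fun n k k' hk =>
    (hD' k k').2 (c'.factor_inj n k k' hk)
  have f2 : ∀ n k k', D k = D k' → factor X ((π^[n] ∘ o) k) ((π^[n] ∘ o) (k + 1)) =
      factor X ((π^[n] ∘ o) k') ((π^[n] ∘ o) (k' + 1)) := fun n k k' hk =>
    (h.toInflation.iterate n).factor_congr (c.strictMono.monotone (Nat.le_succ _))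
      (c.strictMono.monotone (Nat.le_succ _)) ((hD k k').1 hk)
  have f2' : ∀ n k k', D' k = D' k' → factor X ((ρ^[n] ∘ o') k) ((ρ^[n] ∘ o') (k + 1)) =
      factor X ((ρ^[n] ∘ o') k') ((ρ^[n] ∘ o') (k' + 1)) := fun n k k' hk =>
    (h'.toInflation.iterate n).factor_congr (c'.strictMono.monotone (Nat.le_succ _))
      (c'.strictMono.monotone (Nat.le_succ _)) ((hD' k k').1 hk)
  have hP : ∀ n, ∃ P, IsTransfer (π^[n] ∘ o) D (ρ^[m n] ∘ o') D' P := fun n =>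
    exists_isTransfer (mo n) (mo' (m n)) (c.range_comp n) (c'.range_comp (m n)) (hm1 n)
      (f1 n) hDs' (f2' _)
  choose P hP using hP
  have hsub : ∀ n, Set.range (ρ^[m n] ∘ o') ⊆ Set.range (π^[n] ∘ o) := fun n => by
    rw [c.range_comp, c'.range_comp]
    exact prefixOcc_anti (hm1 n)
  have hmem : ∀ n r' r, ∃ N ≤ C * (g * K), P n (Pi.single r' 1) r = (N : ℂ) := by
    intro n r' r
    obtain ⟨k', rfl⟩ := hDs' r'
    have iπ := h.toInflation.iterate n
    have hpos := h.add_le_iterate n one_pos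
    refine (hP n).exists_natCast (mo n) (hsub n) (C := C) (E := π^[n] 1) (by omega) ?_ k'
      ((mo' _).monotone (Nat.le_succ _)) ?_ r
    · intro i
      have := hC n ((π^[n] ∘ o) i) ((π^[n] ∘ o) (i + 1)) 0 (mo n (Nat.lt_succ_self i))
        (c.range_comp n ▸ ⟨i, rfl⟩) (c.range_comp n ▸ ⟨i + 1, rfl⟩)
      simpa [iπ.zero] using this
    · have b1 := (h'.toInflation.iterate (m n)).strictMono.monotone (hg k')
      have b2 := b1.trans (Nat.le_add_mul_of_gap (hm2 n) (o' k') g)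
      simp only [Function.comp]
      calc _ ≤ C * (g * (K * π^[n] 1)) := Nat.mul_le_mul_left _ (by omega)
        _ = _ := by ring
  set U : Set (R' → R → ℂ) :=
    {v | ∀ r', v r' ∈ {w : R → ℂ | ∀ r, w r ∈ (fun N : ℕ => (N : ℂ)) '' Set.Iic (C * (g * K))}}
  have hU : U.Finite := Set.Finite.pi' fun _ => Set.Finite.pi' fun _ => (Set.finite_Iic _).image _
  have : Finite U := hU
  -- Only finitely many matrices have entries in this bounded range, so one of them is `P n` for
  -- infinitely many `n`.
  obtain ⟨⟨v, hv⟩, hfib⟩ := Finite.exists_infinite_fiber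
    (fun n : ℕ => (⟨fun r' => P n (Pi.single r' 1), fun r' r => by
      obtain ⟨N, h1, h2⟩ := hmem n r' r
      exact ⟨N, h1, h2.symm⟩⟩ : U))
  rw [Set.infinite_coe_iff] at hfib
  -- `n > ℓ'` makes the level-`n` prefix long enough for `Q'`; the bound on `n'` forces both `n <
  -- n'` and `m n < m n'`, so both exponents are positive.
  obtain ⟨n, hn, hnℓ⟩ := hfib.exists_gt ℓ'
  obtain ⟨n', hn', hnn'⟩ := hfib.exists_gt (n + ρ^[m n] ℓ')
  have hPP : P n = P n' := by
    apply (Pi.basisFun ℂ R').ext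
    intro r'
    rw [Pi.basisFun_apply]
    exact congrFun (congrArg Subtype.val (hn.trans hn'.symm)) r'
  have hmm : m n < m n' := by
    rw [← (h'.strictMono_iterate_apply c'.pos).lt_iff_lt]
    have := h.add_le_iterate n' c.pos
    have := hm1 n'
    omega
  obtain ⟨p, hp⟩ := Nat.exists_eq_add_of_lt (show n < n' by omega)
  obtain ⟨q, hq⟩ := Nat.exists_eq_add_of_lt hmm
  rw [add_assoc] at hp hq
  -- a transfer map back, and one further down
  have hb : ρ^[m n] ℓ' ≤ π^[n + ρ^[m n] ℓ'] ℓ := by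
    have := h.add_le_iterate (n + ρ^[m n] ℓ') c.pos
    omega
  obtain ⟨Q, hQ⟩ := exists_isTransfer (mo' (m n)) (mo (n + ρ^[m n] ℓ')) (c'.range_comp _)
    (c.range_comp _) hb (f1' _) hDs (f2 _)
  have ha : ρ^[0] ℓ' ≤ π^[n] ℓ := by
    have := h.add_le_iterate n c.pos
    simp only [Function.iterate_zero, id]
    omega
  obtain ⟨Q', hQ'⟩ := exists_isTransfer (mo' 0) (mo n) (c'.range_comp _)
    (c.range_comp _) ha (f1' _) hDs (f2 _)
  refine ⟨p + 1, q + 1, p.succ_pos, q.succ_pos, fun μ hμ => ?_⟩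
  refine hasEigenvalue_pow_iff_of_intertwine (P := P n) (Q := Q) (Q' := Q')
    (a := ρ^[m n] ℓ') (b := m n) p.succ_pos q.succ_pos ?_ ?_ ?_ hμ
  -- Both composites are transfer maps from level `m n'` of `ρ` to level `n` of `π`, so they agree
  -- by uniqueness. The other two identities are obtained likewise.
  · have e1 := c.isTransfer_pow h hS n (p + 1)
    have e2 := c'.isTransfer_pow h' hT (m n) (q + 1)
    rw [← hp] at e1
    rw [← hq] at e2
    have e3 := e1.comp (hP n') (hsub n')
    rw [← hPP] at e3
    exact e3.unique ((hP n).comp e2 (c'.range_subset h' hmm.le)) hDs'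
      ((hsub n').trans (c.range_subset h (by omega)))
  · refine ((hP n).comp hQ ?_).unique (c.isTransfer_pow h hS n _) hDs
      (c.range_subset h (Nat.le_add_right _ _))
    rw [c.range_comp, c'.range_comp]
    exact prefixOcc_anti hb
  · have := c'.isTransfer_pow h' hT 0 (m n)
    rw [zero_add] at this
    refine (hQ'.comp (hP n) (hsub n)).unique this hDs' (c'.range_subset h' (Nat.zero_le _))

omit [Fintype A] in
theorem letterCount_sub_congr {x : ℕ → A} (hx : ∀ i j, x i = x j ↔ X i = X j) {i j d : ℕ}
    (hw : SameWord X i j d) : letterCount x (i + d) - letterCount x i =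
      letterCount x (j + d) - letterCount x j := by
  simp only [letterCount, Finset.sum_range_add, add_sub_cancel_left]
  refine Finset.sum_congr rfl fun t ht => ?_
  rw [(hx _ _).2 (hw t (Finset.mem_range.1 ht))]

/-- Equal factors contain the same return words, up to a bounded number at the right end. -/
theorem ReturnCoding.exists_norm_labelCount_sub_le (h : PrimitiveInflation X π)
    {ℓ : ℕ} {o : ℕ → ℕ} (c : ReturnCoding X π ℓ o) {D : ℕ → R}
    (hD : ∀ k k', D k = D k' ↔ factor X (o k) (o (k + 1)) = factor X (o k') (o (k' + 1))) :
    ∃ B : ℝ, 0 ≤ B ∧ ∀ i j d, SameWord X i j d →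
      ‖(labelCount o D (i + d) - labelCount o D i) -
        (labelCount o D (j + d) - labelCount o D j)‖ ≤ B := by
  obtain ⟨g, hg⟩ := h.exists_occ_gap ℓ
  have hinj := c.strictMono.injective
  have hr : Set.range o = prefixOcc X ℓ := c.range_eq 0
  refine ⟨((g + ℓ : ℕ) : ℝ) * 2, by positivity, fun i j d hw => ?_⟩
  rw [labelCount_add, labelCount_add, add_sub_cancel_left, add_sub_cancel_left,
    ← Finset.sum_sub_distrib]
  -- More than `g + ℓ` from the right end, the next occurrence and its whole prefix lie inside the
  -- common factor, so the labels agree.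
  have hterm : ∀ t ∈ Finset.range d, ‖labelAt o D (i + t) - labelAt o D (j + t)‖ ≤
      if d < t + (g + ℓ) then 2 else 0 := by
    intro t ht
    split_ifs with hlt
    · calc _ ≤ ‖labelAt o D (i + t)‖ + ‖labelAt o D (j + t)‖ := norm_sub_le _ _
        _ ≤ 1 + 1 := add_le_add (norm_labelAt_le o hinj D _) (norm_labelAt_le o hinj D _)
        _ = 2 := by norm_num
    · obtain ⟨s, hs, s1, s2⟩ := hg (i + t)
      obtain ⟨e, rfl⟩ := Nat.exists_eq_add_of_lt s1
      rw [add_assoc _ e 1] at hs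
      have := labelAt_congr c.strictMono hr (fun k k' => (hD k k').2) (i := i + t) (i' := j + t)
        (d := e + 1) (t := 0) (hw.shift (by omega)) hs (Nat.succ_pos e)
      simp only [add_zero] at this
      rw [this, sub_self, norm_zero]
  calc _ ≤ ∑ t ∈ Finset.range d, ‖labelAt o D (i + t) - labelAt o D (j + t)‖ := norm_sum_le _ _
    _ ≤ ∑ t ∈ Finset.range d, if d < t + (g + ℓ) then (2 : ℝ) else 0 := Finset.sum_le_sum hterm
    _ = (((Finset.range d).filter fun t => d < t + (g + ℓ)).card : ℝ) * 2 := by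
      rw [← Finset.sum_filter, Finset.sum_const, nsmul_eq_mul]
    _ ≤ ((g + ℓ : ℕ) : ℝ) * 2 := by
      gcongr
      calc _ ≤ (Finset.Ico (d - (g + ℓ)) d).card := by
            apply Finset.card_le_card
            intro t ht
            simp only [Finset.mem_filter, Finset.mem_range, Finset.mem_Ico] at ht ⊢
            omega
        _ ≤ g + ℓ := by rw [Nat.card_Ico]; omega

/-- The action of an inflation on letter counts and the one on return word counts have the same
eigenvalues of modulus greater than one. -/
theorem ReturnCoding.hasEigenvalue_pow_iff (h : PrimitiveInflation X π)
    {ℓ : ℕ} {o : ℕ → ℕ} (c : ReturnCoding X π ℓ o) {D : ℕ → R} (hDs : Function.Surjective D)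
    (hD : ∀ k k', D k = D k' ↔ factor X (o k) (o (k + 1)) = factor X (o k') (o (k' + 1)))
    {S : Module.End ℂ (R → ℂ)} (hS : IsTransfer o D (π ∘ o) D S)
    {x : ℕ → A} (hxs : Function.Surjective x) (hx : ∀ i j, x i = x j ↔ X i = X j)
    {M : Module.End ℂ (A → ℂ)} (hM : ∀ k, M (letterCount x k) = letterCount x (π k))
    (p : ℕ) {μ : ℂ} (hμ : 1 < ‖μ‖) :
    (M ^ p).HasEigenvalue μ ↔ (S ^ p).HasEigenvalue μ := by
  -- `Θ` counts the letters in each return word; it intertwines `S` and `M`.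
  obtain ⟨Θ, hΘ⟩ := exists_linearMap_letterCount hDs (fun k => letterCount x (o k))
    (by simp [c.apply_zero, letterCount]) (fun k k' hk => by
      obtain ⟨e1, e2⟩ := factor_eq_iff.1 ((hD k k').1 hk)
      have m1 := c.strictMono.monotone (Nat.le_succ k)
      have m2 := c.strictMono.monotone (Nat.le_succ k')
      rw [Nat.succ_eq_add_one] at m1 m2
      have := letterCount_sub_congr hx e2
      rwa [show o k + (o (k + 1) - o k) = o (k + 1) by omega,
        show o k' + (o (k + 1) - o k) = o (k' + 1) by omega] at this)
  have hMp : ∀ j k, (M ^ j) (letterCount x k) = letterCount x (π^[j] k) := by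
    intro j k
    induction j with
    | zero => rfl
    | succ j ih => rw [pow_succ', Module.End.mul_apply, ih, hM, Function.iterate_succ_apply']
  have hSp : ∀ j k k', o k = π^[j] (o k') → (S ^ j) (letterCount D k') = letterCount D k := by
    intro j k k' hk
    have := c.isTransfer_pow h hS 0 j
    rw [zero_add] at this
    exact this k k' hk
  have hidx : ∀ j k', ∃ k, o k = π^[j] (o k') := by
    intro j k'
    have := c.range_subset h (Nat.zero_le j) ⟨k', rfl⟩
    exact this
  have hcomm : ∀ j, Θ ∘ₗ (S ^ j) = (M ^ j) ∘ₗ Θ := by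
    intro j
    apply linearMap_ext_letterCount hDs
    intro k'
    obtain ⟨k, hk⟩ := hidx j k'
    rw [LinearMap.comp_apply, LinearMap.comp_apply, hSp j k k' hk, hΘ, hΘ, hMp, hk]
  obtain ⟨g, hg⟩ := c.gap
  constructor
  · rw [hasEigenvalue_iff_exists_dual, hasEigenvalue_iff_exists_dual]
    rintro ⟨z, hz, hzM⟩
    refine ⟨z ∘ₗ Θ, fun h0 => hz ?_, fun v => ?_⟩
    -- A functional killed by `Θ` vanishes on prefixes ending at occurrences, so it is bounded on
    -- all prefixes. Inflation multiplies its values by powers of `μ`, so they are zero.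
    · have hzo : ∀ k, z (letterCount x (o k)) = 0 := fun k => by
        rw [← hΘ]; exact LinearMap.congr_fun h0 _
      set Z := ∑ a, ‖z (Pi.single a 1)‖
      have hbd : ∀ i, ‖z (letterCount x i)‖ ≤ g * Z := by
        intro i
        obtain ⟨k, k1, k2⟩ := c.strictMono.exists_block c.apply_zero i
        obtain ⟨d, rfl⟩ := Nat.exists_eq_add_of_le k1
        have hdg : d ≤ g := by have := hg k; omega
        have hsum : z (letterCount x (o k + d)) =
            ∑ t ∈ Finset.range d, z (Pi.single (x (o k + t)) 1) := by
          rw [letterCount, Finset.sum_range_add, map_add, ← letterCount, hzo, zero_add, map_sum]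
        rw [hsum]
        calc _ ≤ ∑ t ∈ Finset.range d, ‖z (Pi.single (x (o k + t)) 1)‖ := norm_sum_le _ _
          _ ≤ ∑ t ∈ Finset.range d, Z := Finset.sum_le_sum fun t _ =>
            Finset.single_le_sum (f := fun a => ‖z (Pi.single a 1)‖)
              (fun a _ => norm_nonneg _) (Finset.mem_univ _)
          _ = d * Z := by rw [Finset.sum_const, Finset.card_range, nsmul_eq_mul]
          _ ≤ g * Z := by
            have : 0 ≤ Z := Finset.sum_nonneg fun a _ => norm_nonneg _
            gcongr
      apply linearMap_ext_letterCount hxs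
      intro i
      rw [LinearMap.zero_apply, ← norm_eq_zero]
      refine eq_zero_of_bounded_mul_pow hμ (norm_nonneg _) (B := g * Z) fun n => ?_
      have := dual_pow_apply hzM n (letterCount x i)
      rw [← pow_mul, hMp] at this
      rw [← norm_pow, ← norm_mul, ← this]
      exact hbd _
    · have := LinearMap.congr_fun (hcomm p) v
      simp only [LinearMap.comp_apply] at this ⊢
      rw [this, hzM]
  · rw [hasEigenvalue_iff_exists, hasEigenvalue_iff_exists]
    rintro ⟨y, hy, hyS⟩
    refine ⟨Θ y, fun h0 => hy ?_, ?_⟩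
    · obtain ⟨B, hB0, hB⟩ := c.exists_norm_labelCount_sub_le h hD
      choose s hs using hxs
      -- `N j` counts return words starting inside a chosen occurrence of each `j`-fold inflated
      -- letter. `S ^ j` differs from `N j ∘ Θ` by a bound independent of `j`, so vectors in the
      -- kernel of `Θ` have bounded orbits under `S`.
      set N : ℕ → (A → ℂ) →ₗ[ℂ] (R → ℂ) := fun j => (Pi.basisFun ℂ A).constr ℂ fun a =>
        labelCount o D (π^[j] (s a + 1)) - labelCount o D (π^[j] (s a))
      have hNa : ∀ j a, N j (Pi.single a 1) =
          labelCount o D (π^[j] (s a + 1)) - labelCount o D (π^[j] (s a)) := by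
        intro j a
        have := (Pi.basisFun ℂ A).constr_basis ℂ (fun a =>
          labelCount o D (π^[j] (s a + 1)) - labelCount o D (π^[j] (s a))) a
        rwa [Pi.basisFun_apply] at this
      have hstep : ∀ j i, ‖(labelCount o D (π^[j] (i + 1)) - labelCount o D (π^[j] i)) -
          N j (Pi.single (x i) 1)‖ ≤ B := by
        intro j i
        have ij := h.toInflation.iterate j
        have hw : SameWord X i (s (x i)) 1 := fun t ht => by
          obtain rfl : t = 0 := by omega
          exact ((hx _ _).1 (hs (x i))).symm
        have g1 := ij.gap_of_sameWord hw 1 le_rfl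
        have m1 := ij.strictMono.monotone (Nat.le_succ i)
        rw [Nat.succ_eq_add_one] at m1
        have := hB _ _ _ (ij.sameWord hw)
        rwa [Nat.add_sub_cancel' m1, show π^[j] (s (x i)) + (π^[j] (i + 1) - π^[j] i) =
          π^[j] (s (x i) + 1) by omega, ← hNa] at this
      have hsteps : ∀ j i d, ‖(labelCount o D (π^[j] (i + d)) - labelCount o D (π^[j] i)) -
          N j (letterCount x (i + d) - letterCount x i)‖ ≤ d * B := by
        intro j i d
        induction d with
        | zero => simp
        | succ d ih =>
          have h1 := hstep j (i + d)
          have h2 := norm_add_le_of_le ih h1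
          have e : labelCount o D (π^[j] (i + d + 1)) - labelCount o D (π^[j] i) -
              N j (letterCount x (i + d) + Pi.single (x (i + d)) 1 - letterCount x i) =
              (labelCount o D (π^[j] (i + d)) - labelCount o D (π^[j] i) -
                N j (letterCount x (i + d) - letterCount x i)) +
              (labelCount o D (π^[j] (i + d + 1)) - labelCount o D (π^[j] (i + d)) -
                N j (Pi.single (x (i + d)) 1)) := by
            rw [add_sub_right_comm, map_add]
            abel
          rw [← add_assoc, letterCount_succ, e, Nat.cast_succ, add_mul, one_mul]
          exact h2
      have hbasis : ∀ j r, ‖(S ^ j) (Pi.single r 1) - N j (Θ (Pi.single r 1))‖ ≤ g * B := by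
        intro j r
        obtain ⟨k, rfl⟩ := hDs r
        obtain ⟨k₁, hk₁⟩ := hidx j k
        obtain ⟨k₂, hk₂⟩ := hidx j (k + 1)
        have e : (Pi.single (D k) 1 : R → ℂ) = letterCount D (k + 1) - letterCount D k := by
          rw [letterCount_succ, add_sub_cancel_left]
        have m1 := c.strictMono.monotone (Nat.le_succ k)
        rw [Nat.succ_eq_add_one] at m1
        have h1 := hsteps j (o k) (o (k + 1) - o k)
        rw [Nat.add_sub_cancel' m1, ← hk₁, ← hk₂, labelCount_apply c.strictMono c.apply_zero,
          labelCount_apply c.strictMono c.apply_zero] at h1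
        rw [e, map_sub, map_sub, hSp j k₁ k hk₁, hSp j k₂ (k + 1) hk₂, hΘ, hΘ]
        refine h1.trans ?_
        have : o (k + 1) - o k ≤ g := by have := hg k; omega
        gcongr
      have hy' : ∀ j, ‖(S ^ j) y‖ ≤ ∑ r, ‖y r‖ * (g * B) := by
        intro j
        have e : (S ^ j) y = ((S ^ j) - N j ∘ₗ Θ) y := by
          rw [LinearMap.sub_apply, LinearMap.comp_apply, h0, map_zero, sub_zero]
        have hsum : y = ∑ r, y r • (Pi.single r 1 : R → ℂ) := by
          have := (Pi.basisFun ℂ R).sum_repr y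
          simpa using this.symm
        rw [e]
        conv_lhs => rw [hsum]
        rw [map_sum]
        refine (norm_sum_le _ _).trans (Finset.sum_le_sum fun r _ => ?_)
        rw [map_smul, norm_smul]
        exact mul_le_mul_of_nonneg_left (hbasis j r) (norm_nonneg _)
      rw [← norm_eq_zero]
      refine eq_zero_of_bounded_mul_pow hμ (norm_nonneg _) (B := ∑ r, ‖y r‖ * (g * B)) fun n => ?_
      have := pow_apply_eq_smul hyS n
      rw [← pow_mul] at this
      rw [← norm_pow, ← norm_smul, ← this]
      exact hy' _
    · have := LinearMap.congr_fun (hcomm p) y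
      simp only [LinearMap.comp_apply] at this
      rw [← this, hyS, map_smul]

end Coding

/-- `D` numbers the finitely many return words; `S` is the matrix of the substitution induced on
them, obtained as the transfer map from level one to level zero. -/
theorem PrimitiveInflation.exists_returnSubstitution {L : Type*} {X : ℕ → L} {π : ℕ → ℕ}
    (h : PrimitiveInflation X π) :
    ∃ (ℓ : ℕ) (o : ℕ → ℕ) (r : ℕ) (D : ℕ → Fin r) (S : Module.End ℂ (Fin r → ℂ)),
      ReturnCoding X π ℓ o ∧ Function.Surjective D ∧
      (∀ k k', D k = D k' ↔ factor X (o k) (o (k + 1)) = factor X (o k') (o (k' + 1))) ∧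
      IsTransfer o D (π ∘ o) D S := by
  obtain ⟨ℓ, o, c⟩ := h.exists_returnCoding
  obtain ⟨g, hg⟩ := c.gap
  have : Finite (Set.range fun k => factor X (o k) (o (k + 1))) := finite_range_factor h.finite hg
  obtain ⟨r, ⟨e⟩⟩ := Finite.exists_equiv_fin (Set.range fun k => factor X (o k) (o (k + 1)))
  set D : ℕ → Fin r := e ∘ Set.rangeFactorization fun k => factor X (o k) (o (k + 1))
  have hDs : Function.Surjective D := e.surjective.comp Set.rangeFactorization_surjective
  have hD : ∀ k k', D k = D k' ↔
      factor X (o k) (o (k + 1)) = factor X (o k') (o (k' + 1)) := fun k k' => by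
    exact e.injective.eq_iff.trans Subtype.ext_iff
  have hm := c.strictMono.monotone
  obtain ⟨S, hS⟩ := exists_isTransfer c.strictMono (h.strictMono.comp c.strictMono)
    (c.range_eq 0) (c.range_eq 1) (h.strictMono.id_le ℓ) (fun k k' => (hD k k').2) hDs
    (fun k k' hk => h.factor_congr (hm (Nat.le_succ _)) (hm (Nat.le_succ _)) ((hD k k').1 hk))
  exact ⟨ℓ, o, r, D, S, c, hDs, hD, hS⟩

/-! ### Kronecker's theorem and Galois conjugates. -/

section Conjugates

variable {m n : Type*} [Fintype m] [DecidableEq m] [Fintype n] [DecidableEq n]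

theorem Matrix.hasEigenvalue_intCast_iff_aeval (M : Matrix n n ℤ) (μ : ℂ) :
    Module.End.HasEigenvalue (Matrix.toLin' (M.map (Int.cast : ℤ → ℂ))) μ ↔
      Polynomial.aeval μ M.charpoly = 0 := by
  rw [Module.End.hasEigenvalue_iff_isRoot_charpoly, Matrix.charpoly_toLin']
  have := Matrix.charpoly_map M (Int.castRingHom ℂ)
  rw [Int.coe_castRingHom] at this
  rw [this, Polynomial.IsRoot.def, Polynomial.eval_map, Polynomial.aeval_def]
  rfl

/-- If every eigenvalue of modulus greater than one of the integer matrix `M` is an eigenvalue of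
`N`, then so is every nonzero eigenvalue that is not a root of unity. -/
theorem Matrix.hasEigenvalue_intCast_of_one_lt_norm (M : Matrix m m ℤ) (N : Matrix n n ℤ)
    (h : ∀ ν : ℂ, 1 < ‖ν‖ →
      (Module.End.HasEigenvalue (Matrix.toLin' (M.map (Int.cast : ℤ → ℂ))) ν ↔
        Module.End.HasEigenvalue (Matrix.toLin' (N.map (Int.cast : ℤ → ℂ))) ν))
    {μ : ℂ} (h0 : μ ≠ 0) (h1 : ¬ IsRootOfUnity μ)
    (hM : Module.End.HasEigenvalue (Matrix.toLin' (M.map (Int.cast : ℤ → ℂ))) μ) :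
    Module.End.HasEigenvalue (Matrix.toLin' (N.map (Int.cast : ℤ → ℂ))) μ := by
  simp only [Matrix.hasEigenvalue_intCast_iff_aeval] at *
  have hint : IsIntegral ℤ μ := ⟨M.charpoly, M.charpoly_monic, hM⟩
  have hintQ : IsIntegral ℚ μ := hint.tower_top
  have : FiniteDimensional ℚ (IntermediateField.adjoin ℚ {μ}) :=
    IntermediateField.adjoin.finiteDimensional hintQ
  have : NumberField (IntermediateField.adjoin ℚ {μ}) := ⟨⟩
  set x := IntermediateField.AdjoinSimple.gen ℚ μ
  have hxμ : algebraMap (IntermediateField.adjoin ℚ {μ}) ℂ x = μ :=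
    IntermediateField.AdjoinSimple.algebraMap_gen ℚ μ
  have hinj : Function.Injective (algebraMap (IntermediateField.adjoin ℚ {μ}) ℂ) :=
    (algebraMap (IntermediateField.adjoin ℚ {μ}) ℂ).injective
  have hroot : ∀ (φ : IntermediateField.adjoin ℚ {μ} →+* ℂ) (P : Polynomial ℤ),
      Polynomial.aeval (φ x) P = 0 ↔ Polynomial.aeval x P = 0 := by
    intro φ P
    have : Polynomial.aeval (φ x) P = φ (Polynomial.aeval x P) :=
      Polynomial.aeval_algHom_apply φ.toIntAlgHom x P
    rw [this, map_eq_zero]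
  -- If all conjugates of `μ` lie in the closed unit disc, Kronecker's theorem makes `μ` a root of
  -- unity. Otherwise `h` applies to a conjugate outside the disc, and integer polynomials vanish
  -- there exactly when they vanish at `μ`.
  by_cases hall : ∀ φ : IntermediateField.adjoin ℚ {μ} →+* ℂ, ‖φ x‖ ≤ 1
  · exfalso
    have hx0 : x ≠ 0 := fun h => h0 (by rw [← hxμ, h, map_zero])
    have hxi : IsIntegral ℤ x := by
      rw [← hxμ] at hint
      exact (isIntegral_algebraMap_iff hinj).1 hint
    obtain ⟨k, hk, e⟩ := NumberField.Embeddings.pow_eq_one_of_norm_le_one _ ℂ hx0 hxi hall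
    exact h1 ⟨k, hk, by rw [← hxμ, ← map_pow, e, map_one]⟩
  · push Not at hall
    obtain ⟨φ, hφ⟩ := hall
    rw [← hxμ, hroot] at hM ⊢
    exact (hroot φ _).1 ((h _ hφ).1 ((hroot φ _).2 hM))

end Conjugates

/-! ### From substitutions to inflations of the fixed point. -/

namespace Substitution

variable {α : Type*} (τ : Substitution α) (x : ℕ → α)

theorem seqPrefix_succ (k : ℕ) : seqPrefix x (k + 1) = seqPrefix x k ++ [x k] := by
  rw [seqPrefix, List.ofFn_succ', List.concat_eq_append]
  rfl

theorem length_seqPrefix (k : ℕ) : (seqPrefix x k).length = k := List.length_ofFn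

theorem getElem_seqPrefix (k n : ℕ) (h : n < (seqPrefix x k).length) :
    (seqPrefix x k)[n] = x n := by
  simp [seqPrefix]

theorem applyWord_append (v w : List α) :
    τ.applyWord (v ++ w) = τ.applyWord v ++ τ.applyWord w := List.flatMap_append

theorem applyWord_seqPrefix_prefix {k k' : ℕ} (h : k ≤ k') :
    τ.applyWord (seqPrefix x k) <+: τ.applyWord (seqPrefix x k') := by
  induction k', h using Nat.le_induction with
  | base => exact List.prefix_rfl
  | succ n _ ih =>
    rw [seqPrefix_succ, applyWord_append]
    exact ih.trans (List.prefix_append _ _)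

/-- The length of the image of the prefix of length `k`. -/
def position (k : ℕ) : ℕ := (τ.applyWord (seqPrefix x k)).length

theorem position_succ (k : ℕ) : τ.position x (k + 1) = τ.position x k + (τ.map (x k)).length := by
  rw [position, seqPrefix_succ, applyWord_append, List.length_append]
  simp [position, applyWord]

variable {τ x}

/-- `applySeq` reads letter `n` in the image of the prefix of length `n + 1`; images of prefixes are
nested, so any long enough one shows the same letter. -/
theorem IsFixedPoint.applyWord_seqPrefix (hx : τ.IsFixedPoint x) (k : ℕ) :
    τ.applyWord (seqPrefix x k) = seqPrefix x (τ.position x k) := by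
  refine List.ext_getElem (length_seqPrefix _ _).symm fun n h1 h2 => ?_
  have hn : n < (τ.applyWord (seqPrefix x (n + 1))).length := by
    have := τ.length_le_length_applyWord (seqPrefix x (n + 1))
    rw [length_seqPrefix] at this
    omega
  have h3 : x n = (τ.applyWord (seqPrefix x (n + 1)))[n] := (congrFun hx.2 n).symm
  rw [getElem_seqPrefix, h3]
  rcases le_total k (n + 1) with h | h
  · exact (τ.applyWord_seqPrefix_prefix x h).getElem h1
  · exact ((τ.applyWord_seqPrefix_prefix x h).getElem hn).symm

theorem IsFixedPoint.apply_position_add (hx : τ.IsFixedPoint x) (k t : ℕ)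
    (ht : t < (τ.map (x k)).length) : x (τ.position x k + t) = (τ.map (x k))[t] := by
  have h1 := hx.applyWord_seqPrefix (k + 1)
  have hlt : τ.position x k + t < τ.position x (k + 1) := by
    rw [position_succ]; omega
  have h2 : x (τ.position x k + t) = (seqPrefix x (τ.position x (k + 1)))[τ.position x k + t]'(by
      rwa [length_seqPrefix]) := (getElem_seqPrefix _ _ _ _).symm
  rw [h2]
  simp only [← h1, seqPrefix_succ, applyWord_append]
  rw [List.getElem_append_right (by simp [position])]
  simp [position, applyWord]

/-- Only equality of letters matters, so `x` can be replaced by a sequence `X` shared by both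
alphabets. -/
theorem IsFixedPoint.inflation (hx : τ.IsFixedPoint x) {L : Type*} {X : ℕ → L}
    (hX : ∀ i j, x i = x j ↔ X i = X j) : Inflation X (τ.position x) where
  zero := by simp [position, seqPrefix, applyWord]
  strictMono := strictMono_nat_of_lt_succ fun n => by
    have := List.length_pos_iff.mpr (τ.map_ne_nil (x n))
    rw [position_succ]
    omega
  gap := fun {i j} hij => by
    rw [position_succ, position_succ, (hX i j).2 hij]
    omega
  word := fun {i j} hij t ht => by
    rw [position_succ] at ht
    have e := (hX i j).2 hij
    rw [← hX, hx.apply_position_add i t (by omega),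
      hx.apply_position_add j t (by rw [← e]; omega)]
    simp only [e]

theorem IsFixedPoint.iterate_applyWord_seqPrefix (hx : τ.IsFixedPoint x) (n k : ℕ) :
    τ.applyWord^[n] (seqPrefix x k) = seqPrefix x ((τ.position x)^[n] k) := by
  induction n with
  | zero => rfl
  | succ n ih =>
    rw [Function.iterate_succ_apply', ih, hx.applyWord_seqPrefix, Function.iterate_succ_apply']

variable [DecidableEq α]

/-- The number of occurrences of each letter in a word. -/
def countVec (w : List α) : α → ℤ := fun a => w.count a

theorem countVec_append (v w : List α) : countVec (v ++ w) = countVec v + countVec w := by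
  ext a
  simp [countVec]

theorem countVec_singleton (b : α) : countVec [b] = Pi.single b 1 := by
  ext a
  rcases eq_or_ne a b with rfl | h
  · simp [countVec]
  · simp [countVec, h, h.symm]

theorem exists_of_count_lt {a : α} {m n : ℕ} (hmn : m ≤ n)
    (h : countVec (seqPrefix x m) a < countVec (seqPrefix x n) a) :
    ∃ t, m ≤ t ∧ t < n ∧ x t = a := by
  induction n, hmn using Nat.le_induction with
  | base => exact absurd h (lt_irrefl _)
  | succ n hmn ih =>
    by_cases hn : x n = a
    · exact ⟨n, hmn, Nat.lt_succ_self n, hn⟩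
    · rw [seqPrefix_succ, countVec_append, countVec_singleton, Pi.add_apply,
        Pi.single_eq_of_ne (Ne.symm hn), add_zero] at h
      obtain ⟨t, h1, h2, h3⟩ := ih h
      exact ⟨t, h1, h2.trans (Nat.lt_succ_self n), h3⟩

variable [Fintype α]

theorem countVec_applyWord (τ : Substitution α) (w : List α) :
    countVec (τ.applyWord w) = τ.matrix.mulVec (countVec w) := by
  induction w with
  | nil => ext a; simp [applyWord, countVec, Matrix.mulVec, dotProduct]
  | cons b w ih =>
    have h1 : τ.applyWord (b :: w) = τ.map b ++ τ.applyWord w := List.flatMap_cons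
    have h2 : countVec (b :: w) = Pi.single b 1 + countVec w := by
      rw [← countVec_singleton, ← countVec_append]; rfl
    rw [h1, h2, countVec_append, ih, Matrix.mulVec_add, Matrix.mulVec_single_one]
    rfl

theorem countVec_iterate_applyWord (τ : Substitution α) (n : ℕ) (w : List α) :
    countVec (τ.applyWord^[n] w) = (τ.matrix ^ n).mulVec (countVec w) := by
  induction n with
  | zero => simp
  | succ n ih =>
    rw [Function.iterate_succ_apply', countVec_applyWord, ih, Matrix.mulVec_mulVec, pow_succ']

theorem matrix_pow (τ : Substitution α) (n : ℕ) : (τ.pow n).matrix = τ.matrix ^ n := by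
  ext a b
  have := congrFun (τ.countVec_iterate_applyWord n [b]) a
  rw [countVec_singleton, Matrix.mulVec_single_one] at this
  exact this

/-- The letter counts at the two positions differ by the column of `τ.matrix ^ k` indexed by `x i`,
which is positive. -/
theorem IsFixedPoint.exists_occurrence (hx : τ.IsFixedPoint x) {k : ℕ}
    (hk : ∀ i j, 0 < (τ.matrix ^ k) i j) (i : ℕ) (a : α) :
    ∃ t, (τ.position x)^[k] i ≤ t ∧ t < (τ.position x)^[k] (i + 1) ∧ x t = a := by
  apply exists_of_count_lt
  · exact ((hx.inflation fun _ _ => Iff.rfl).iterate k).strictMono.monotone (Nat.le_succ i)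
  · rw [← hx.iterate_applyWord_seqPrefix, ← hx.iterate_applyWord_seqPrefix,
      countVec_iterate_applyWord, countVec_iterate_applyWord, seqPrefix_succ, countVec_append,
      countVec_singleton, Matrix.mulVec_add, Matrix.mulVec_single_one, Pi.add_apply]
    exact lt_add_of_pos_right _ (hk a (x i))

theorem IsFixedPoint.surjective (hx : τ.IsFixedPoint x) (hτ : τ.IsPrimitive) :
    Function.Surjective x := by
  obtain ⟨k, -, hk⟩ := hτ.exists_pos_pow
  intro a
  obtain ⟨t, -, -, ht⟩ := hx.exists_occurrence hk 0 a
  exact ⟨t, ht⟩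

theorem IsFixedPoint.primitiveInflation (hx : τ.IsFixedPoint x) (hτ : τ.IsPrimitive)
    {L : Type*} {X : ℕ → L} (hX : ∀ i j, x i = x j ↔ X i = X j) (hper : ¬ UltimatelyPeriodic X) :
    PrimitiveInflation X (τ.position x) where
  toInflation := hx.inflation hX
  prim := by
    obtain ⟨k, -, hk⟩ := hτ.exists_pos_pow
    refine ⟨k, fun i i' => ?_⟩
    obtain ⟨t, h1, h2, h3⟩ := hx.exists_occurrence hk i (x i')
    exact ⟨t, h1, h2, (hX _ _).1 h3⟩
  finite := finite_range_of_factor (Set.toFinite (Set.range x)) fun i j => (hX i j).1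
  aperiodic := hper

omit [Fintype α] in
theorem letterCount_eq_countVec (x : ℕ → α) (k : ℕ) :
    letterCount x k = fun a => ((countVec (seqPrefix x k) a : ℤ) : ℂ) := by
  induction k with
  | zero => ext a; simp [letterCount, countVec, seqPrefix]
  | succ k ih =>
    rw [letterCount_succ, ih, seqPrefix_succ, countVec_append, countVec_singleton]
    ext a
    simp [Pi.single_apply]

theorem IsFixedPoint.toLin'_letterCount (hx : τ.IsFixedPoint x) (k : ℕ) :
    Matrix.toLin' (τ.matrix.map (Int.cast : ℤ → ℂ)) (letterCount x k) =
      letterCount x (τ.position x k) := by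
  rw [letterCount_eq_countVec, letterCount_eq_countVec, ← hx.applyWord_seqPrefix,
    countVec_applyWord, Matrix.toLin'_apply]
  ext a
  simp [Matrix.mulVec, dotProduct]

theorem isEigenvalue_pow_iff (τ : Substitution α) (p : ℕ) (μ : ℂ) :
    (τ.pow p).IsEigenvalue μ ↔
      Module.End.HasEigenvalue (Matrix.toLin' (τ.matrix.map (Int.cast : ℤ → ℂ)) ^ p) μ := by
  have : (τ.matrix ^ p).map (Int.cast : ℤ → ℂ) = τ.matrix.map (Int.cast : ℤ → ℂ) ^ p :=
    map_pow (Int.castRingHom ℂ).mapMatrix τ.matrix p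
  rw [IsEigenvalue, matrix_pow, this, Matrix.toLin'_pow]

end Substitution

/-! ### The main theorem. -/

theorem mainTheorem2 {L : Type*} [DecidableEq L] (A B : Finset L)
    (τ : Substitution A) (σ : Substitution B)
    (hτ : τ.IsPrimitive) (hσ : σ.IsPrimitive)
    (X : ℕ → L) (x : ℕ → A) (y : ℕ → B)
    (hx : τ.IsFixedPoint x) (hy : σ.IsFixedPoint y)
    (hxX : ∀ n, (x n : L) = X n) (hyX : ∀ n, (y n : L) = X n)
    (hX : ¬ UltimatelyPeriodic X) :
    ∃ p q : ℕ, 0 < p ∧ 0 < q ∧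
      ∀ μ : ℂ, μ ≠ 0 → ¬ IsRootOfUnity μ →
        ((τ.pow p).IsEigenvalue μ ↔ (σ.pow q).IsEigenvalue μ) := by
  have hx' : ∀ i j, x i = x j ↔ X i = X j := fun i j => by rw [Subtype.ext_iff, hxX, hxX]
  have hy' : ∀ i j, y i = y j ↔ X i = X j := fun i j => by rw [Subtype.ext_iff, hyX, hyX]
  have h := hx.primitiveInflation hτ hx' hX
  have h' := hy.primitiveInflation hσ hy' hX
  obtain ⟨ℓ, o, r, D, S, c, hDs, hD, hS⟩ := h.exists_returnSubstitution
  obtain ⟨ℓ', o', r', D', T, c', hDs', hD', hT⟩ := h'.exists_returnSubstitution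
  obtain ⟨p, q, hp, hq, hpq⟩ := exists_pow_hasEigenvalue_iff h h' c c' hDs hD hDs' hD' hS hT
  refine ⟨p, q, hp, hq, fun μ h0 h1 => ?_⟩
  -- Outside the unit disc eigenvalues pass from letters to return words for `τ`, across to those of
  -- `σ`, and back to letters.
  have key : ∀ ν : ℂ, 1 < ‖ν‖ → ((τ.pow p).IsEigenvalue ν ↔ (σ.pow q).IsEigenvalue ν) := by
    intro ν hν
    have hν0 : ν ≠ 0 := by
      rintro rfl
      rw [norm_zero] at hν
      exact absurd hν (by norm_num)
    rw [Substitution.isEigenvalue_pow_iff, Substitution.isEigenvalue_pow_iff,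
      c.hasEigenvalue_pow_iff h hDs hD hS (hx.surjective hτ) hx' hx.toLin'_letterCount p hν,
      c'.hasEigenvalue_pow_iff h' hDs' hD' hT (hy.surjective hσ) hy' hy.toLin'_letterCount q hν]
    exact hpq ν hν0
  exact ⟨Matrix.hasEigenvalue_intCast_of_one_lt_norm _ _ key h0 h1,
    Matrix.hasEigenvalue_intCast_of_one_lt_norm _ _ (fun ν hν => (key ν hν).symm) h0 h1⟩
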